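/- Let $(M,\mathcal M,\mu)$ be a probability space and let $\varphi\colon\mathbb R\times M\to M$ be a jointly measurable flow ($\varphi^0=\mathrm{Id}$, $\varphi^{t+s}=\varphi^t\circ\varphi^s$) such that every $\varphi^t$ preserves $\mu$; ergodicity is not assumed. Let $\mathcal G^1$ be the set of measurable maps $A\colon M\to\mathbb R^{2\times2}$ with $\int_M\|A\|\,d\mu<\infty$. For $A\in\mathcal G^1$ let $\Phi_A(t,\omega)$ denote the Carathéodory solution along the orbit of $\omega$, i.e. the continuous solution of $$\Phi_A(t,\omega)=\mathrm{Id}+\int_0^tA(\varphi^s(\omega))\,\Phi_A(s,\omega)\,ds\qquad(t\in\mathbb R),$$ where $s\mapsto A(\varphi^s(\omega))$ is required to be locally integrable (set $\Phi_A(t,\omega)=\mathrm{Id}$ at those $\omega$ for which there is no such solution). Let $$\lambda_1(A,\omega)=\sup_{v\in\mathbb R^2\setminus\{0\}}\ \limsup_{t\to+\infty}\frac1t\log\|\Phi_A(t,\omega)v\|$$ be the top Lyapunov exponent. For $1\le p<\infty$ put $\hat\sigma_p(A,B)=\left(\int_M\|A-B\|^p\,d\mu\right)^{1/p}\in[0,\infty]$,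 and $\sigma_p(A,B)=\hat\sigma_p(A,B)/(1+\hat\sigma_p(A,B))$ if $\hat\sigma_p(A,B)<\infty$, $\sigma_p(A,B)=1$ otherwise. Then for every $A\in\mathcal G^1$ the solution $\Phi_A(\cdot,\omega)$ exists and is unique for $\mu$-almost every $\omega$, the exponent $\lambda_1(A,\omega)$ is finite for $\mu$-almost every $\omega$, and $\lambda_1(A,\cdot)$ is $\mu$-integrable, so that $\mathscr L(A)=\int_M\lambda_1(A,\omega)\,d\mu(\omega)$ is a well-defined real number. Moreover, for every $1\le p<\infty$ the function $\mathscr L\colon\mathcal G^1\to\mathbb R$ is upper semicontinuous for $\sigma_p$: for all $A\in\mathcal G^1$ and $\varepsilon>0$ there is $\delta>0$ such that, for all $B\in\mathcal G^1$, $\sigma_p(A,B)<\delta$ implies $\mathscr L(B)<\mathscr L(A)+\varepsilon$. -/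

import Mathlib

open MeasureTheory Filter Topology
open scoped ENNReal Matrix Matrix.Norms.L2Operator

namespace LinearCocycle

/-- Real `2 × 2` matrices; the norm in force is the operator norm of the Euclidean plane. -/
abbrev Mat := Matrix (Fin 2) (Fin 2) ℝ

/-- The Euclidean plane. -/
abbrev Plane := EuclideanSpace ℝ (Fin 2)

/-- `φ` is a metric dynamical system (a jointly measurable, measure preserving flow) on the
measure space `(M, μ)`. Ergodicity is not required. -/
structure IsMeasurePreservingFlow {M : Type*} [MeasurableSpace M] (μ : Measure M)
    (φ : ℝ → M → M) : Prop where
  measurable_uncurry : Measurable (Function.uncurry φ)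
  measurePreserving : ∀ t, MeasurePreserving (φ t) μ μ
  map_zero : φ 0 = id
  map_add : ∀ t s, φ (t + s) = φ t ∘ φ s

/-- The integrable generators: measurable `A : M → ℝ^{2×2}` with `∫ ‖A‖ dμ < ∞`.
(For maps into the separable space of matrices, strong measurability is Borel measurability.) -/
def integrableGenerators {M : Type*} [MeasurableSpace M] (μ : Measure M) : Set (M → Mat) :=
  {A | StronglyMeasurable A ∧ Integrable A μ}

/-- The extended distance `(∫ ‖A - B‖ ^ p dμ) ^ (1 / p) ∈ [0, ∞]`. -/
noncomputable def sigmaHat {M : Type*} [MeasurableSpace M] (μ : Measure M) (p : ℝ≥0∞)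
    (A B : M → Mat) : ℝ≥0∞ :=
  eLpNorm (fun ω => A ω - B ω) p μ

open Classical in
/-- The bounded distance on generators: `σ̂ / (1 + σ̂)` if `σ̂ < ∞`, and `1` otherwise. -/
noncomputable def sigma {M : Type*} [MeasurableSpace M] (μ : Measure M) (p : ℝ≥0∞)
    (A B : M → Mat) : ℝ :=
  if sigmaHat μ p A B < ∞ then
    (sigmaHat μ p A B).toReal / (1 + (sigmaHat μ p A B).toReal)
  else 1

/-- `X` is a Carathéodory (weak) fundamental solution of `Ẋ = A(φ^t ω) X` along the orbit of `ω`: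
the coefficient is locally integrable in time, `X` is continuous, and
`X(t) = Id + ∫_0^t A(φ^s ω) X(s) ds` for every real `t`. -/
structure IsCaratheodorySolution {M : Type*} (φ : ℝ → M → M) (A : M → Mat) (ω : M)
    (X : ℝ → Mat) : Prop where
  locallyIntegrable : LocallyIntegrable (fun s => A (φ s ω)) volume
  continuous : Continuous X
  integral_eq : ∀ t : ℝ, X t = 1 + ∫ s in (0 : ℝ)..t, A (φ s ω) * X s

open Classical in
/-- The linear cocycle `Φ_A(t, ω)` generated by `A`: for each `ω` the Carathéodory solution along
the orbit of `ω`, and the identity at those exceptional `ω` that admit no solution. -/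
noncomputable def cocycle {M : Type*} (φ : ℝ → M → M) (A : M → Mat) (t : ℝ) (ω : M) : Mat :=
  if h : ∃ X : ℝ → Mat, IsCaratheodorySolution φ A ω X then h.choose t else 1

/-- The Lyapunov exponent `limsup_{t → +∞} (1 / t) log ‖Φ_A(t, ω) v‖` of the vector `v`. -/
noncomputable def vectorExponent {M : Type*} (φ : ℝ → M → M) (A : M → Mat) (ω : M)
    (v : Plane) : EReal :=
  limsup (fun t : ℝ =>
    ((Real.log ‖Matrix.toEuclideanCLM (𝕜 := ℝ) (cocycle φ A t ω) v‖ / t : ℝ) : EReal)) atTop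

/-- The top Lyapunov exponent `λ₁(A, ω)`, the largest exponent of a nonzero vector. -/
noncomputable def topExponent {M : Type*} (φ : ℝ → M → M) (A : M → Mat) (ω : M) : EReal :=
  ⨆ (v : Plane) (_ : v ≠ 0), vectorExponent φ A ω v

/-- The functional `𝓛(A) = ∫ λ₁(A, ω) dμ(ω)`. -/
noncomputable def integratedTopExponent {M : Type*} [MeasurableSpace M] (μ : Measure M)
    (φ : ℝ → M → M) (A : M → Mat) : ℝ :=
  ∫ ω, (topExponent φ A ω).toReal ∂μ

/-- Consistency of the definition: at every `ω` with an Oseledets splitting `E₁ ⊕ E₂` and exponents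
`l₁ ≥ l₂`, the top exponent is `l₁`. -/
theorem topExponent_eq_of_splitting {M : Type*} (φ : ℝ → M → M) (A : M → Mat) (ω : M)
    (hdet : ∀ t, (cocycle φ A t ω).det ≠ 0) (E₁ E₂ : Submodule ℝ Plane) (h₁ : E₁ ≠ ⊥)
    (hE : IsCompl E₁ E₂) (l₁ l₂ : ℝ) (hl : l₂ ≤ l₁)
    (ht₁ : ∀ v ∈ E₁, v ≠ 0 → Tendsto (fun t : ℝ =>
      Real.log ‖Matrix.toEuclideanCLM (𝕜 := ℝ) (cocycle φ A t ω) v‖ / t) atTop (𝓝 l₁))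
    (ht₂ : ∀ v ∈ E₂, v ≠ 0 → Tendsto (fun t : ℝ =>
      Real.log ‖Matrix.toEuclideanCLM (𝕜 := ℝ) (cocycle φ A t ω) v‖ / t) atTop (𝓝 l₂)) :
    topExponent φ A ω = (l₁ : EReal) := by
  have hne : ∀ t, ∀ v : Plane, v ≠ 0 →
      Matrix.toEuclideanCLM (𝕜 := ℝ) (cocycle φ A t ω) v ≠ 0 := by
    intro t v hv h0
    apply hv
    have hu : IsUnit (cocycle φ A t ω) :=
      (Matrix.isUnit_iff_isUnit_det _).2 (isUnit_iff_ne_zero.2 (hdet t))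
    obtain ⟨u, hu⟩ := hu
    have : Matrix.toEuclideanCLM (𝕜 := ℝ) ((↑u⁻¹ : Mat) * cocycle φ A t ω) v = 0 := by
      rw [map_mul, mul_apply_eq_comp, h0, map_zero]
    rwa [← hu, Units.inv_mul, map_one] at this
  have key : ∀ (v : Plane) (l : ℝ), l ≤ l₁ → (v ≠ 0 → Tendsto (fun t : ℝ =>
      Real.log ‖Matrix.toEuclideanCLM (𝕜 := ℝ) (cocycle φ A t ω) v‖ / t) atTop (𝓝 l)) →
      ∀ ε > 0, ∀ᶠ t : ℝ in atTop,
        ‖Matrix.toEuclideanCLM (𝕜 := ℝ) (cocycle φ A t ω) v‖ ≤ Real.exp ((l₁ + ε) * t) := by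
    intro v l hl' hv ε hε
    by_cases h0 : v = 0
    · filter_upwards with t
      rw [h0, map_zero, norm_zero]
      exact (Real.exp_pos _).le
    · filter_upwards [(hv h0).eventually_lt_const (show l < l₁ + ε by linarith),
        eventually_gt_atTop (0 : ℝ)] with t ht ht0
      rw [div_lt_iff₀ ht0] at ht
      exact ((Real.log_le_iff_le_exp (norm_pos_iff.2 (hne t v h0))).1 ht.le)
  apply le_antisymm
  · refine iSup₂_le fun v hv => ?_
    obtain ⟨a, ha, b, hb, hab⟩ : ∃ a ∈ E₁, ∃ b ∈ E₂, a + b = v :=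
      Submodule.mem_sup.1 (hE.sup_eq_top ▸ Submodule.mem_top)
    have hε : ∀ ε : ℝ, 0 < ε → vectorExponent φ A ω v ≤ ((l₁ + 2 * ε : ℝ) : EReal) := by
      intro ε hε
      refine limsup_le_of_le (by isBoundedDefault) ?_
      have hlog : ∀ᶠ t : ℝ in atTop, Real.log 2 ≤ ε * t :=
        (tendsto_id.const_mul_atTop hε).eventually_ge_atTop _
      filter_upwards [key a l₁ le_rfl (ht₁ a ha) ε hε, key b l₂ hl (ht₂ b hb) ε hε,
        eventually_gt_atTop (0 : ℝ), hlog] with t hat hbt ht0 hlt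
      rw [EReal.coe_le_coe_iff, div_le_iff₀ ht0,
        Real.log_le_iff_le_exp (norm_pos_iff.2 (hne t v hv)), ← hab, map_add]
      have h2 : (2 : ℝ) ≤ Real.exp (ε * t) := by
        rwa [← Real.log_le_iff_le_exp (by norm_num)]
      calc _ ≤ _ := norm_add_le _ _
        _ ≤ 2 * Real.exp ((l₁ + ε) * t) := by linarith
        _ ≤ Real.exp (ε * t) * Real.exp ((l₁ + ε) * t) := by gcongr
        _ = _ := by rw [← Real.exp_add]; ring_nf
    refine EReal.le_of_forall_lt_iff_le.1 fun z hz => ?_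
    have hz' : l₁ < z := by exact_mod_cast hz
    have := hε ((z - l₁) / 2) (by linarith)
    rwa [show l₁ + 2 * ((z - l₁) / 2) = z by ring] at this
  · obtain ⟨v, hv, hv0⟩ := Submodule.exists_mem_ne_zero_of_ne_bot h₁
    have hlim : vectorExponent φ A ω v = (l₁ : EReal) :=
      ((continuous_coe_real_ereal.tendsto l₁).comp (ht₁ v hv hv0)).limsup_eq
    rw [← hlim]
    exact le_iSup₂_of_le v hv0 le_rfl

end LinearCocycle

/-! The semicontinuity rests on the formula L(A) = inf over n ≥ 1 of (1/n) ∫ log‖Φ_A(n, ω)‖ dμ. Each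
term is upper semicontinuous for the L¹ distance, which on a probability space is dominated by every
L^p distance, and an infimum of upper semicontinuous functions is upper semicontinuous.

Everything is controlled by the energy ∫_0^t ‖A(φ^s ω)‖ ds, which is integrable in ω by Fubini and
invariance. Grönwall's inequality and invertibility of the cocycle give |log‖Φ_A(t, ω)‖| ≤ energy
for t ≥ 0. Since the exponent equals the limsup of log‖Φ_A(t, ω)‖ / t, Birkhoff's theorem for the
energy makes it finite and integrable, and allows it to be computed along multiples of any N > 0.

The formula needs only two inequalities, not the full subadditive ergodic theorem. For ≤,
log‖Φ_A(kN, ω)‖ is at most a Birkhoff sum of log‖Φ_A(N, ·)‖ (`integratedTopExponent_le`). For ≥,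
Fatou's lemma applies to the nonnegative functions (energy − log norm)/n
(`exists_integral_logNorm_lt`).

For fixed n, `integral_logNorm_le` bounds ∫ log‖Φ_B(n, ·)‖ by the same integral for A, plus a
constant times the L¹ distance, plus an energy tail that depends on A alone. No smallness of B − A
along individual orbits is required. -/

namespace LinearCocycle

/-! ### Absolute continuity, local integrability and Grönwall's inequality -/

theorem _root_.AbsolutelyContinuousOnInterval.lipschitzOnWith_comp {f g : ℝ → ℝ} {a b : ℝ}
    {K : NNReal} {s : Set ℝ} (hf : AbsolutelyContinuousOnInterval f a b)
    (hg : LipschitzOnWith K g s) (hs : Set.MapsTo f (Set.uIcc a b) s) :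
    AbsolutelyContinuousOnInterval (fun x => g (f x)) a b := by
  rw [absolutelyContinuousOnInterval_iff] at hf ⊢
  intro ε hε
  obtain ⟨δ, hδ, h⟩ := hf (ε / (K + 1)) (by positivity)
  refine ⟨δ, hδ, fun E hE hE' => ?_⟩
  have h1 := h E hE hE'
  calc _ ≤ ∑ i ∈ Finset.range E.1, (K : ℝ) * dist (f (E.2 i).1) (f (E.2 i).2) :=
        Finset.sum_le_sum fun i hi =>
          hg.dist_le_mul _ (hs (hE.1 i hi).1) _ (hs (hE.1 i hi).2)
    _ = K * ∑ i ∈ Finset.range E.1, dist (f (E.2 i).1) (f (E.2 i).2) := by rw [Finset.mul_sum]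
    _ ≤ K * (ε / (K + 1)) := by gcongr
    _ < (K + 1) * (ε / (K + 1)) := by gcongr; linarith
    _ = ε := by field

theorem _root_.AbsolutelyContinuousOnInterval.exp {f : ℝ → ℝ} {a b : ℝ}
    (hf : AbsolutelyContinuousOnInterval f a b) :
    AbsolutelyContinuousOnInterval (fun x => Real.exp (f x)) a b := by
  obtain ⟨C, hC⟩ := hf.exists_bound
  obtain ⟨K, hK⟩ := (Real.contDiff_exp (n := 1)).contDiffOn.exists_lipschitzOnWith (by decide)
    (convex_Icc (-C) C) isCompact_Icc
  exact hf.lipschitzOnWith_comp hK fun x hx => abs_le.1 (by simpa using hC x hx)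

theorem _root_.MeasureTheory.LocallyIntegrable.intervalIntegrable {E : Type*}
    [NormedAddCommGroup E] {f : ℝ → E} (hf : LocallyIntegrable f volume) (s t : ℝ) :
    IntervalIntegrable f volume s t :=
  intervalIntegrable_iff.mpr
    ((hf.integrableOn_isCompact isCompact_uIcc).mono_set Set.uIoc_subset_uIcc)

theorem _root_.MeasureTheory.locallyIntegrable_of_intervalIntegrable {E : Type*}
    [NormedAddCommGroup E] {f : ℝ → E} (hf : ∀ s t, IntervalIntegrable f volume s t) :
    LocallyIntegrable f volume := fun x =>
  ⟨Set.Ioc (x - 1) (x + 1), Ioc_mem_nhds (by linarith) (by linarith),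
    (intervalIntegrable_iff_integrableOn_Ioc_of_le (by linarith)).1 (hf (x - 1) (x + 1))⟩

theorem _root_.MeasureTheory.LocallyIntegrable.norm_comp {E : Type*}
    [NormedAddCommGroup E] {f : ℝ → E} (hf : LocallyIntegrable f volume) :
    LocallyIntegrable (fun x => ‖f x‖) volume := fun x => (hf x).norm

theorem _root_.MeasureTheory.LocallyIntegrable.comp_neg_real {E : Type*}
    [NormedAddCommGroup E] {f : ℝ → E} (hf : LocallyIntegrable f volume) :
    LocallyIntegrable (fun x => f (-x)) volume :=
  locallyIntegrable_of_intervalIntegrable fun s t => by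
    simpa using (hf.intervalIntegrable (-s) (-t)).comp_sub_left 0

theorem _root_.MeasureTheory.LocallyIntegrable.comp_add_real {E : Type*}
    [NormedAddCommGroup E] {f : ℝ → E} (hf : LocallyIntegrable f volume) (c : ℝ) :
    LocallyIntegrable (fun x => f (x + c)) volume :=
  locallyIntegrable_of_intervalIntegrable fun s t => by
    simpa using (hf.intervalIntegrable (s + c) (t + c)).comp_add_right c

theorem _root_.MeasureTheory.LocallyIntegrable.absolutelyContinuousOnInterval {f : ℝ → ℝ}
    (hf : LocallyIntegrable f volume) (s t : ℝ) :
    AbsolutelyContinuousOnInterval (fun x => ∫ r in (0 : ℝ)..x, f r) s t :=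
  (IntervalIntegrable.absolutelyContinuousOnInterval_intervalIntegral (c := 0)
    (hf.intervalIntegrable (min (min s t) 0) (max (max s t) 0)) (by
      rw [Set.mem_uIcc]; left; simp)).mono (by
      rw [Set.uIcc_subset_uIcc_iff_mem]
      constructor <;> rw [Set.mem_uIcc] <;> left <;> simp)

/-- Only measurability of `X` is asked for: the lemma serves the pointwise limit of the Picard
iterates, whose continuity is deduced afterwards from the integral equation. -/
theorem _root_.MeasureTheory.LocallyIntegrable.mul_of_norm_le {E : Type*} [NormedRing E]
    {a X : ℝ → E} (ha : LocallyIntegrable a volume) (hX : AEStronglyMeasurable X volume)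
    {g : ℝ → ℝ} (hg : Continuous g) (h : ∀ t, ‖X t‖ ≤ g t) :
    LocallyIntegrable (fun t => a t * X t) volume := by
  refine locallyIntegrable_of_intervalIntegrable fun s t => ?_
  refine ((ha.norm_comp.intervalIntegrable s t).mul_continuousOn hg.continuousOn).mono_fun
    (ha.aestronglyMeasurable.mul hX).restrict (ae_of_all _ fun r => ?_)
  refine le_trans ?_ (le_abs_self _)
  exact (norm_mul_le _ _).trans (by gcongr; exact h r)

/-- The primitive of a locally integrable rate is differentiable only almost everywhere, so the
fundamental theorem of calculus is used in its absolutely continuous form. -/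
theorem integral_mul_exp_primitive {a : ℝ → ℝ} (ha : LocallyIntegrable a volume) {c : ℝ}
    (hc : c ≠ 0) (s t : ℝ) :
    ∫ r in s..t, a r * Real.exp (c * ∫ x in (0 : ℝ)..r, a x) =
      (Real.exp (c * ∫ x in (0 : ℝ)..t, a x) - Real.exp (c * ∫ x in (0 : ℝ)..s, a x)) / c := by
  have h1 := ((ha.absolutelyContinuousOnInterval s t).const_mul c).exp
  rw [← h1.integral_deriv_eq_sub, ← intervalIntegral.integral_div]
  refine intervalIntegral.integral_congr_ae ?_
  filter_upwards [_root_.LocallyIntegrable.ae_hasDerivAt_integral ha] with r hr _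
  rw [((hr 0).const_mul c).exp.deriv]
  field_simp

/-- Grönwall's inequality with a locally integrable rate. -/
theorem le_mul_exp_of_le_add_integral {a u : ℝ → ℝ} (ha : LocallyIntegrable a volume)
    (ha0 : ∀ t, 0 ≤ a t) (hu : Continuous u) {c T : ℝ} (hT : 0 ≤ T)
    (h : ∀ t ∈ Set.Icc 0 T, u t ≤ c + ∫ r in (0 : ℝ)..t, a r * u r) :
    u T ≤ c * Real.exp (∫ r in (0 : ℝ)..T, a r) := by
  have hau : LocallyIntegrable (fun r => a r * u r) volume := ha.mul_continuous hu
  set F : ℝ → ℝ := fun x => ∫ r in (0 : ℝ)..x, a r with hF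
  set V : ℝ → ℝ := fun x => c + ∫ r in (0 : ℝ)..x, a r * u r with hV
  have hVac : AbsolutelyContinuousOnInterval V 0 T :=
    (contDiffOn_const (c := c)).absolutelyContinuousOnInterval.add
      (hau.absolutelyContinuousOnInterval 0 T)
  have hWac := hVac.fun_mul ((ha.absolutelyContinuousOnInterval 0 T).const_mul (-1)).exp
  -- The integrating factor: u ≤ V makes the a.e. derivative a(u − V)e^{−F} of V e^{−F} nonpositive,
  -- and absolute continuity turns this into a comparison of endpoint values.
  have hle : ∫ x in (0 : ℝ)..T, deriv (fun x => V x * Real.exp (-1 * F x)) x ≤ 0 := by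
    rw [intervalIntegral.integral_of_le hT]
    refine setIntegral_nonpos_of_ae_restrict ?_
    refine (ae_restrict_iff' measurableSet_Ioc).2 ?_
    filter_upwards [_root_.LocallyIntegrable.ae_hasDerivAt_integral ha,
      _root_.LocallyIntegrable.ae_hasDerivAt_integral hau] with r h1 h2 hr
    have hd := ((h2 0).const_add c).mul ((h1 0).const_mul (-1)).exp
    have h3 := hd.deriv
    change deriv (fun x => V x * Real.exp (-1 * F x)) r = _ at h3
    rw [h3]
    have h4 : u r ≤ V r := h r ⟨hr.1.le, hr.2⟩
    have h5 : a r * u r ≤ a r * V r := mul_le_mul_of_nonneg_left h4 (ha0 r)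
    have h6 : 0 ≤ Real.exp (-1 * F r) := (Real.exp_pos _).le
    change a r * u r * Real.exp (-1 * F r) + V r * (Real.exp (-1 * F r) * (-1 * a r)) ≤ 0
    nlinarith
  rw [hWac.integral_deriv_eq_sub] at hle
  have h0 : V 0 * Real.exp (-1 * F 0) = c := by simp [hV, hF]
  have h1 : V T * Real.exp (-1 * F T) ≤ c := by
    change V T * Real.exp (-1 * F T) - V 0 * Real.exp (-1 * F 0) ≤ 0 at hle
    linarith
  have h2 : Real.exp (-1 * F T) * Real.exp (F T) = 1 := by rw [← Real.exp_add]; simp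
  calc u T ≤ V T := h T ⟨hT, le_rfl⟩
    _ = V T * Real.exp (-1 * F T) * Real.exp (F T) := by rw [mul_assoc, h2, mul_one]
    _ ≤ c * Real.exp (F T) := by gcongr

/-! ### Linear integral equations in a normed algebra -/

section LinearIntegralEquation

variable {E : Type*} [NormedRing E] [NormedAlgebra ℝ E] {a b X Y : ℝ → E} {x : E}

/-- Time reversal, which reduces estimates at negative times to positive ones. -/
theorem integral_equation_reflect (h : ∀ t, X t = x + ∫ s in (0 : ℝ)..t, a s * X s) (t : ℝ) :
    X (-t) = x + ∫ s in (0 : ℝ)..t, -a (-s) * X (-s) := by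
  rw [h (-t)]
  simp only [neg_mul, intervalIntegral.integral_neg]
  rw [intervalIntegral.integral_comp_neg (fun s => a s * X s), intervalIntegral.integral_symm]
  simp

theorem norm_le_of_integral_equation_of_nonneg (ha : LocallyIntegrable a volume)
    (hX : Continuous X) (h : ∀ t, X t = x + ∫ s in (0 : ℝ)..t, a s * X s) {t : ℝ} (ht : 0 ≤ t) :
    ‖X t‖ ≤ ‖x‖ * Real.exp (∫ s in (0 : ℝ)..t, ‖a s‖) := by
  refine le_mul_exp_of_le_add_integral ha.norm_comp (fun _ => norm_nonneg _) hX.norm ht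
    fun r hr => ?_
  calc ‖X r‖ = ‖x + ∫ s in (0 : ℝ)..r, a s * X s‖ := by rw [← h r]
    _ ≤ ‖x‖ + ‖∫ s in (0 : ℝ)..r, a s * X s‖ := norm_add_le _ _
    _ ≤ ‖x‖ + ∫ s in (0 : ℝ)..r, ‖a s‖ * ‖X s‖ := by
      gcongr
      exact intervalIntegral.norm_integral_le_of_norm_le hr.1
        (ae_of_all _ fun s _ => norm_mul_le _ _)
        ((ha.norm_comp.mul_continuous hX.norm).intervalIntegrable 0 r)

theorem norm_le_of_integral_equation (ha : LocallyIntegrable a volume)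
    (hX : Continuous X) (h : ∀ t, X t = x + ∫ s in (0 : ℝ)..t, a s * X s) (t : ℝ) :
    ‖X t‖ ≤ ‖x‖ * Real.exp |∫ s in (0 : ℝ)..t, ‖a s‖| := by
  rcases le_total 0 t with ht | ht
  · refine (norm_le_of_integral_equation_of_nonneg ha hX h ht).trans ?_
    gcongr
    exact le_abs_self _
  · have := norm_le_of_integral_equation_of_nonneg (X := fun t => X (-t)) (a := fun s => -a (-s))
      ha.comp_neg_real.neg (hX.comp continuous_neg) (integral_equation_reflect h)
      (neg_nonneg.2 ht)
    simp only [neg_neg, norm_neg] at this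
    rw [intervalIntegral.integral_comp_neg (fun s => ‖a s‖), neg_neg, neg_zero,
      intervalIntegral.integral_symm] at this
    refine this.trans ?_
    gcongr
    exact neg_le_abs _

theorem integral_equation_unique (ha : LocallyIntegrable a volume)
    (hX : Continuous X) (h : ∀ t, X t = x + ∫ s in (0 : ℝ)..t, a s * X s)
    (hY : Continuous Y) (h' : ∀ t, Y t = x + ∫ s in (0 : ℝ)..t, a s * Y s) : X = Y := by
  have hD : ∀ t, X t - Y t = 0 + ∫ s in (0 : ℝ)..t, a s * (X s - Y s) := fun t => by
    conv_lhs => rw [h t, h' t]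
    simp only [mul_sub]
    rw [intervalIntegral.integral_sub ((ha.mul_continuous hX).intervalIntegrable 0 t)
      ((ha.mul_continuous hY).intervalIntegrable 0 t)]
    abel
  funext t
  have := norm_le_of_integral_equation (X := fun t => X t - Y t) ha (hX.sub hY) hD t
  rw [norm_zero, zero_mul] at this
  exact sub_eq_zero.1 (norm_le_zero_iff.1 this)

/-- The difference Y − X solves the equation of `a` with forcing (b − a)Y. Bounding Y by its own
exponential estimate makes the forcing a constant for Grönwall's inequality with rate ‖a‖. -/
theorem norm_sub_le_of_integral_equation (ha : LocallyIntegrable a volume)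
    (hb : LocallyIntegrable b volume)
    (hX : Continuous X) (h : ∀ t, X t = x + ∫ s in (0 : ℝ)..t, a s * X s)
    (hY : Continuous Y) (h' : ∀ t, Y t = x + ∫ s in (0 : ℝ)..t, b s * Y s)
    {t : ℝ} (ht : 0 ≤ t) :
    ‖Y t - X t‖ ≤ (∫ s in (0 : ℝ)..t, ‖b s - a s‖) *
      (‖x‖ * Real.exp ((∫ s in (0 : ℝ)..t, ‖a s‖) + ∫ s in (0 : ℝ)..t, ‖b s - a s‖)) *
        Real.exp (∫ s in (0 : ℝ)..t, ‖a s‖) := by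
  have hba : LocallyIntegrable (fun s => b s - a s) volume := hb.sub ha
  refine le_mul_exp_of_le_add_integral (u := fun t => ‖Y t - X t‖) ha.norm_comp
    (fun _ => norm_nonneg _) (hY.sub hX).norm ht fun r hr => ?_
  have mono : ∀ c : ℝ → E, LocallyIntegrable c volume → ∀ s ∈ Set.Icc 0 t,
      ∫ q in (0 : ℝ)..s, ‖c q‖ ≤ ∫ q in (0 : ℝ)..t, ‖c q‖ := fun c hc s hs =>
    intervalIntegral.integral_mono_interval le_rfl hs.1 hs.2
      (ae_of_all _ fun _ => norm_nonneg _) (hc.norm_comp.intervalIntegrable 0 t)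
  have hYb : ∀ s ∈ Set.Icc 0 t, ‖Y s‖ ≤
      ‖x‖ * Real.exp ((∫ s in (0 : ℝ)..t, ‖a s‖) + ∫ s in (0 : ℝ)..t, ‖b s - a s‖) := by
    intro s hs
    refine (norm_le_of_integral_equation_of_nonneg hb hY h' hs.1).trans ?_
    gcongr
    refine (mono b hb s hs).trans ?_
    rw [← intervalIntegral.integral_add (ha.norm_comp.intervalIntegrable 0 t)
      (hba.norm_comp.intervalIntegrable 0 t)]
    refine intervalIntegral.integral_mono_on ht (hb.norm_comp.intervalIntegrable 0 t)
      ((ha.norm_comp.intervalIntegrable 0 t).add (hba.norm_comp.intervalIntegrable 0 t)) fun q _ => ?_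
    simpa using norm_add_le (a q) (b q - a q)
  set C := ‖x‖ * Real.exp ((∫ s in (0 : ℝ)..t, ‖a s‖) + ∫ s in (0 : ℝ)..t, ‖b s - a s‖) with hC
  have hC0 : 0 ≤ C := by positivity
  have hD : Y r - X r = (∫ s in (0 : ℝ)..r, (b s - a s) * Y s) +
      ∫ s in (0 : ℝ)..r, a s * (Y s - X s) := by
    rw [h r, h' r, ← intervalIntegral.integral_add ((hba.mul_continuous hY).intervalIntegrable 0 r)
      ((ha.mul_continuous (g := fun s => Y s - X s) (hY.sub hX)).intervalIntegrable 0 r), add_sub_add_left_eq_sub,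
      ← intervalIntegral.integral_sub ((hb.mul_continuous hY).intervalIntegrable 0 r)
      ((ha.mul_continuous hX).intervalIntegrable 0 r)]
    congr 1 with s
    noncomm_ring
  have h1 : ‖∫ s in (0 : ℝ)..r, (b s - a s) * Y s‖ ≤ (∫ s in (0 : ℝ)..t, ‖b s - a s‖) * C := by
    refine (intervalIntegral.norm_integral_le_of_norm_le hr.1
      (g := fun s => ‖b s - a s‖ * C)
      (ae_of_all _ fun s hs => (norm_mul_le _ _).trans ?_)
      ((hba.norm_comp.intervalIntegrable 0 r).mul_const _)).trans ?_
    · gcongr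
      exact hYb s ⟨hs.1.le, hs.2.trans hr.2⟩
    · rw [intervalIntegral.integral_mul_const]
      gcongr
      exact mono _ hba r hr
  have h2 : ‖∫ s in (0 : ℝ)..r, a s * (Y s - X s)‖ ≤ ∫ s in (0 : ℝ)..r, ‖a s‖ * ‖Y s - X s‖ :=
    intervalIntegral.norm_integral_le_of_norm_le hr.1
        (ae_of_all _ fun s _ => norm_mul_le _ _)
        ((ha.norm_comp.mul_continuous (hY.sub hX).norm).intervalIntegrable 0 r)
  rw [hD]
  exact (norm_add_le _ _).trans (add_le_add h1 h2)

/-- The factor 2 in the weight exp(2|F|) comes out as 1/2 after integration. In the corresponding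
weighted sup norm the Picard map is a contraction on the whole line at once, so no local solutions
need be glued. -/
theorem abs_integral_mul_exp_abs_primitive_le {a : ℝ → ℝ} (ha : LocallyIntegrable a volume)
    (ha0 : ∀ t, 0 ≤ a t) (t : ℝ) :
    |∫ r in (0 : ℝ)..t, a r * Real.exp (2 * |∫ s in (0 : ℝ)..r, a s|)| ≤
      (Real.exp (2 * |∫ s in (0 : ℝ)..t, a s|) - 1) / 2 := by
  rcases le_total 0 t with ht | ht
  · have hF : ∀ r, 0 ≤ r → |∫ s in (0 : ℝ)..r, a s| = ∫ s in (0 : ℝ)..r, a s := fun r hr =>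
      abs_of_nonneg (intervalIntegral.integral_nonneg hr fun s _ => ha0 s)
    have : ∫ r in (0 : ℝ)..t, a r * Real.exp (2 * |∫ s in (0 : ℝ)..r, a s|) =
        (Real.exp (2 * |∫ s in (0 : ℝ)..t, a s|) - 1) / 2 := by
      have h1 := integral_mul_exp_primitive ha two_ne_zero 0 t
      rw [intervalIntegral.integral_same, mul_zero, Real.exp_zero] at h1
      rw [hF t ht, ← h1]
      refine intervalIntegral.integral_congr fun r hr => ?_
      rw [Set.uIcc_of_le ht] at hr
      simp only [hF r hr.1]
    rw [this, abs_of_nonneg]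
    have : 1 ≤ Real.exp (2 * |∫ s in (0 : ℝ)..t, a s|) := Real.one_le_exp (by positivity)
    linarith
  · have hF : ∀ r, r ≤ 0 → |∫ s in (0 : ℝ)..r, a s| = -∫ s in (0 : ℝ)..r, a s := fun r hr => by
      refine abs_of_nonpos ?_
      rw [intervalIntegral.integral_symm]
      exact neg_nonpos.2 (intervalIntegral.integral_nonneg hr fun s _ => ha0 s)
    have : ∫ r in (0 : ℝ)..t, a r * Real.exp (2 * |∫ s in (0 : ℝ)..r, a s|) =
        -((Real.exp (2 * |∫ s in (0 : ℝ)..t, a s|) - 1) / 2) := by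
      have h1 := integral_mul_exp_primitive ha (c := -2) (by norm_num) 0 t
      rw [intervalIntegral.integral_same, mul_zero, Real.exp_zero] at h1
      rw [hF t ht, mul_neg, ← neg_mul, ← div_neg, ← h1]
      refine intervalIntegral.integral_congr fun r hr => ?_
      rw [Set.uIcc_of_ge ht] at hr
      simp only [hF r hr.2, mul_neg, neg_mul]
    rw [this, abs_neg, abs_of_nonneg]
    have : 1 ≤ Real.exp (2 * |∫ s in (0 : ℝ)..t, a s|) := Real.one_le_exp (by positivity)
    linarith

/-- The Picard iterates of the equation `X(t) = 1 + ∫_0^t a(s) X(s) ds`. -/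
noncomputable def picard (a : ℝ → E) : ℕ → ℝ → E
  | 0 => fun _ => 1
  | n + 1 => fun t => 1 + ∫ s in (0 : ℝ)..t, a s * picard a n s

theorem continuous_picard (ha : LocallyIntegrable a volume) (n : ℕ) :
    Continuous (picard a n) := by
  induction n with
  | zero => exact continuous_const
  | succ n ih =>
    exact continuous_const.add (intervalIntegral.continuous_primitive
      (fun s t => (ha.mul_continuous ih).intervalIntegrable s t) 0)

theorem norm_integral_mul_le_of_norm_le (ha : LocallyIntegrable a volume) {c : ℝ} (hc : 0 ≤ c)
    (hX : ∀ t, ‖X t‖ ≤ c * Real.exp (2 * |∫ s in (0 : ℝ)..t, ‖a s‖|)) (t : ℝ) :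
    ‖∫ s in (0 : ℝ)..t, a s * X s‖ ≤
      c * ((Real.exp (2 * |∫ s in (0 : ℝ)..t, ‖a s‖|) - 1) / 2) := by
  have hcont : Continuous fun t => Real.exp (2 * |∫ s in (0 : ℝ)..t, ‖a s‖|) := by
    have := intervalIntegral.continuous_primitive (fun s t => ha.norm_comp.intervalIntegrable s t) 0
    fun_prop
  refine (intervalIntegral.norm_integral_le_abs_of_norm_le
    (g := fun s => c * (‖a s‖ * Real.exp (2 * |∫ r in (0 : ℝ)..s, ‖a r‖|)))
    (ae_of_all _ fun s => (norm_mul_le _ _).trans ?_)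
    (((ha.norm_comp.mul_continuous hcont).intervalIntegrable 0 t).const_mul c)).trans ?_
  · rw [mul_left_comm]
    gcongr
    exact hX s
  · rw [intervalIntegral.integral_const_mul, abs_mul, abs_of_nonneg hc]
    gcongr
    exact abs_integral_mul_exp_abs_primitive_le ha.norm_comp (fun _ => norm_nonneg _) t

variable [NormOneClass E]

theorem norm_picard_le (ha : LocallyIntegrable a volume) (n : ℕ) (t : ℝ) :
    ‖picard a n t‖ ≤ 2 * Real.exp (2 * |∫ s in (0 : ℝ)..t, ‖a s‖|) := by
  induction n generalizing t with
  | zero =>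
    have : 1 ≤ Real.exp (2 * |∫ s in (0 : ℝ)..t, ‖a s‖|) := Real.one_le_exp (by positivity)
    simp only [picard, norm_one]
    linarith
  | succ n ih =>
    have h1 := norm_integral_mul_le_of_norm_le ha zero_le_two ih t
    have h2 : 1 ≤ Real.exp (2 * |∫ s in (0 : ℝ)..t, ‖a s‖|) := Real.one_le_exp (by positivity)
    have h3 := norm_add_le (1 : E) (∫ s in (0 : ℝ)..t, a s * picard a n s)
    rw [norm_one] at h3
    simp only [picard]
    linarith

theorem norm_picard_succ_sub_le (ha : LocallyIntegrable a volume) (n : ℕ) (t : ℝ) :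
    ‖picard a (n + 1) t - picard a n t‖ ≤
      (1 / 2 : ℝ) ^ n * Real.exp (2 * |∫ s in (0 : ℝ)..t, ‖a s‖|) := by
  induction n generalizing t with
  | zero =>
    have h1 := norm_integral_mul_le_of_norm_le ha (X := fun _ => 1) zero_le_one (fun t => by
      rw [norm_one, one_mul]; exact Real.one_le_exp (by positivity)) t
    have h2 := Real.exp_pos (2 * |∫ s in (0 : ℝ)..t, ‖a s‖|)
    simp only [picard, add_sub_cancel_left, pow_zero, one_mul]
    linarith
  | succ n ih =>
    have h1 := norm_integral_mul_le_of_norm_le ha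
      (X := fun t => picard a (n + 1) t - picard a n t) (by positivity) ih t
    have h2 : picard a (n + 1 + 1) t - picard a (n + 1) t =
        ∫ s in (0 : ℝ)..t, a s * (picard a (n + 1) s - picard a n s) := by
      simp only [mul_sub]
      rw [intervalIntegral.integral_sub
        ((ha.mul_continuous (continuous_picard ha _)).intervalIntegrable 0 t)
        ((ha.mul_continuous (continuous_picard ha _)).intervalIntegrable 0 t)]
      simp only [picard, add_sub_add_left_eq_sub]
    rw [h2]
    refine h1.trans ?_
    rw [pow_succ, mul_assoc]
    gcongr
    linarith

theorem exists_tendsto_picard [CompleteSpace E] (ha : LocallyIntegrable a volume) :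
    ∃ X : ℝ → E, Continuous X ∧ (∀ t, X t = 1 + ∫ s in (0 : ℝ)..t, a s * X s) ∧
      ∀ t, Tendsto (fun n => picard a n t) atTop (𝓝 (X t)) := by
  have hcau : ∀ t, CauchySeq fun n => picard a n t := fun t =>
    cauchySeq_of_le_geometric (1 / 2) (Real.exp (2 * |∫ s in (0 : ℝ)..t, ‖a s‖|)) (by norm_num)
      fun n => by
        rw [dist_comm, dist_eq_norm, mul_comm]
        exact norm_picard_succ_sub_le ha n t
  choose X hX using fun t => cauchySeq_tendsto_of_complete (hcau t)
  have hcont : Continuous fun t => 2 * Real.exp (2 * |∫ s in (0 : ℝ)..t, ‖a s‖|) := by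
    have := intervalIntegral.continuous_primitive (fun s t => ha.norm_comp.intervalIntegrable s t) 0
    fun_prop
  have hXb : ∀ t, ‖X t‖ ≤ 2 * Real.exp (2 * |∫ s in (0 : ℝ)..t, ‖a s‖|) := fun t =>
    le_of_tendsto (hX t).norm (Eventually.of_forall fun n => norm_picard_le ha n t)
  have hXm : AEStronglyMeasurable X volume :=
    aestronglyMeasurable_of_tendsto_ae atTop
      (fun n => (continuous_picard ha n).aestronglyMeasurable) (ae_of_all _ hX)
  have haX := ha.mul_of_norm_le hXm hcont hXb
  have heq : ∀ t, X t = 1 + ∫ s in (0 : ℝ)..t, a s * X s := by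
    -- Dominated convergence in the Picard recursion, with the uniform weighted bound on the
    -- iterates as majorant.
    intro t
    refine tendsto_nhds_unique ((tendsto_add_atTop_iff_nat 1).2 (hX t)) ?_
    refine Tendsto.const_add 1 ?_
    refine intervalIntegral.tendsto_integral_filter_of_dominated_convergence
      (fun s => ‖a s‖ * (2 * Real.exp (2 * |∫ r in (0 : ℝ)..s, ‖a r‖|)))
      (Eventually.of_forall fun n =>
        ((ha.mul_continuous (continuous_picard ha n)).aestronglyMeasurable).restrict)
      (Eventually.of_forall fun n => ae_of_all _ fun s _ => (norm_mul_le _ _).trans ?_)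
      ((ha.norm_comp.mul_continuous hcont).intervalIntegrable 0 t)
      (ae_of_all _ fun s _ => (hX s).const_mul _)
    gcongr
    exact norm_picard_le ha n s
  refine ⟨X, ?_, heq, hX⟩
  rw [funext heq]
  exact continuous_const.add (intervalIntegral.continuous_primitive
    (fun s t => haX.intervalIntegrable s t) 0)

end LinearIntegralEquation

/-! ### Birkhoff's ergodic theorem -/

section Birkhoff

variable {M : Type*} {T : M → M} {f : M → ℝ}

/-- The running maximum `max (0, S_1 f, …, S_n f)` of the Birkhoff sums. -/
noncomputable def birkhoffMax (T : M → M) (f : M → ℝ) : ℕ → M → ℝ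
  | 0 => fun _ => 0
  | n + 1 => fun x => max 0 (f x + birkhoffMax T f n (T x))

theorem birkhoffMax_nonneg (n : ℕ) (x : M) : 0 ≤ birkhoffMax T f n x := by
  cases n with
  | zero => exact le_rfl
  | succ n => exact le_max_left _ _

theorem birkhoffMax_le_succ (n : ℕ) (x : M) : birkhoffMax T f n x ≤ birkhoffMax T f (n + 1) x := by
  induction n generalizing x with
  | zero => exact le_max_left _ _
  | succ n ih =>
    change max 0 (f x + birkhoffMax T f n (T x)) ≤ max 0 (f x + birkhoffMax T f (n + 1) (T x))
    gcongr
    exact ih _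

theorem birkhoffSum_le_birkhoffMax (n : ℕ) (x : M) : birkhoffSum T f n x ≤ birkhoffMax T f n x := by
  induction n generalizing x with
  | zero => simp [birkhoffMax]
  | succ n ih =>
    rw [birkhoffSum_succ']
    exact le_max_of_le_right (by gcongr; exact ih _)

variable [MeasurableSpace M] {μ : Measure M}

theorem measurable_birkhoffMax (hT : Measurable T) (hf : Measurable f) (n : ℕ) :
    Measurable (birkhoffMax T f n) := by
  induction n with
  | zero => exact measurable_const
  | succ n ih => exact measurable_const.max (hf.add (ih.comp hT))

theorem integrable_birkhoffMax (hT : MeasurePreserving T μ μ) (hf : Integrable f μ) (n : ℕ) :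
    Integrable (birkhoffMax T f n) μ := by
  induction n with
  | zero => exact integrable_zero _ _ _
  | succ n ih =>
    have := (integrable_zero M ℝ μ).sup (hf.add (hT.integrable_comp_of_integrable ih))
    exact this

/-- Garsia's argument: where the maximum M is positive, f ≥ M − M ∘ T. Since M vanishes off that set
and is nonnegative everywhere, invariance of μ makes the integral of M − M ∘ T over it nonnegative.
-/
theorem setIntegral_birkhoffMax_pos_nonneg (hT : MeasurePreserving T μ μ) (hf : Integrable f μ)
    (hfm : Measurable f) (n : ℕ) : 0 ≤ ∫ x in {x | 0 < birkhoffMax T f n x}, f x ∂μ := by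
  cases n with
  | zero => simp [birkhoffMax]
  | succ n =>
    set P := {x | 0 < birkhoffMax T f (n + 1) x} with hP
    have hPm : MeasurableSet P :=
      measurableSet_lt measurable_const (measurable_birkhoffMax hT.measurable hfm _)
    have hM := integrable_birkhoffMax hT hf (n + 1)
    have hMT : Integrable (fun x => birkhoffMax T f (n + 1) (T x)) μ :=
      hT.integrable_comp_of_integrable hM
    have h1 : ∫ x in P, birkhoffMax T f (n + 1) x ∂μ = ∫ x, birkhoffMax T f (n + 1) x ∂μ :=
      setIntegral_eq_integral_of_forall_compl_eq_zero fun x hx =>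
        le_antisymm (not_lt.1 hx) (birkhoffMax_nonneg _ _)
    have h2 : ∫ x in P, birkhoffMax T f (n + 1) (T x) ∂μ ≤
        ∫ x, birkhoffMax T f (n + 1) (T x) ∂μ :=
      setIntegral_le_integral hMT (ae_of_all _ fun x => birkhoffMax_nonneg _ _)
    have h3 : ∫ x, birkhoffMax T f (n + 1) (T x) ∂μ = ∫ x, birkhoffMax T f (n + 1) x ∂μ := by
      have := integral_map hT.measurable.aemeasurable (f := birkhoffMax T f (n + 1)) (μ := μ)
        (by rw [hT.map_eq]; exact hM.aestronglyMeasurable)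
      rw [← this, hT.map_eq]
    have h4 : ∫ x in P, (birkhoffMax T f (n + 1) x - birkhoffMax T f (n + 1) (T x)) ∂μ ≤
        ∫ x in P, f x ∂μ := by
      refine setIntegral_mono_on (hM.sub hMT).integrableOn hf.integrableOn hPm fun x hx => ?_
      have hx' : 0 < max 0 (f x + birkhoffMax T f n (T x)) := hx
      have h5 : birkhoffMax T f (n + 1) x = f x + birkhoffMax T f n (T x) :=
        max_eq_right ((lt_max_iff.1 hx').resolve_left (lt_irrefl _)).le
      have := birkhoffMax_le_succ (T := T) (f := f) n (T x)
      linarith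
    rw [integral_sub hM.integrableOn hMT.integrableOn] at h4
    linarith

/-- The maximal ergodic inequality. -/
theorem integral_nonneg_of_exists_birkhoffSum_pos (hT : MeasurePreserving T μ μ)
    (hf : Integrable f μ) (hfm : Measurable f) (h : ∀ᵐ x ∂μ, ∃ n, 0 < birkhoffSum T f n x) :
    0 ≤ ∫ x, f x ∂μ := by
  have hmono : Monotone fun n => {x | 0 < birkhoffMax T f n x} :=
    monotone_nat_of_le_succ fun n x hx => lt_of_lt_of_le hx (birkhoffMax_le_succ n x)
  have ht := tendsto_setIntegral_of_monotone (μ := μ) (f := f)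
    (fun n => measurableSet_lt measurable_const (measurable_birkhoffMax hT.measurable hfm n))
    hmono hf.integrableOn
  have hU : (⋃ n, {x | 0 < birkhoffMax T f n x} : Set M) =ᵐ[μ] Set.univ := by
    refine eventuallyEq_univ.2 ?_
    filter_upwards [h] with x ⟨n, hn⟩
    exact Set.mem_iUnion.2 ⟨n, hn.trans_le (birkhoffSum_le_birkhoffMax n x)⟩
  rw [setIntegral_congr_set hU, setIntegral_univ] at ht
  exact ge_of_tendsto' ht fun n => setIntegral_birkhoffMax_pos_nonneg hT hf hfm n

/-- Let g = f − (E[f | invariants] + ε). The set E where the Birkhoff sums of g are unbounded above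
is invariant, so T preserves μ restricted to E and the maximal inequality gives 0 ≤ ∫_E g.
Conditioning gives ∫_E g = −ε μ(E), whence μ(E) = 0. -/
theorem ae_bddAbove_birkhoffSum_sub_condExp [IsFiniteMeasure μ] (hT : MeasurePreserving T μ μ)
    (hf : Integrable f μ) (hfm : Measurable f) {ε : ℝ} (hε : 0 < ε) :
    ∀ᵐ x ∂μ, ∃ K : ℕ, ∀ n : ℕ, birkhoffSum T f n x ≤
      n * ((μ[f|MeasurableSpace.invariants T]) x + ε) + K := by
  have hIle : MeasurableSpace.invariants T ≤ ‹MeasurableSpace M› := MeasurableSpace.invariants_le T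
  set fs := μ[f|MeasurableSpace.invariants T] with hfs
  have hfsm : Measurable[MeasurableSpace.invariants T] fs := stronglyMeasurable_condExp.measurable
  have hfsT : fs ∘ T = fs := MeasurableSpace.comp_eq_of_measurable_invariants hfsm
  set g : M → ℝ := fun x => f x - (fs x + ε) with hg
  have hgm : Measurable g := hfm.sub ((hfsm.mono hIle le_rfl).add_const ε)
  have hgi : Integrable g μ := hf.sub (integrable_condExp.add (integrable_const ε))
  have hsum : ∀ n x, birkhoffSum T g n x = birkhoffSum T f n x - n * (fs x + ε) := by
    intro n x
    have h1 : (fun x => fs x + ε) ∘ T = fun x => fs x + ε := by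
      funext y; exact congrArg (· + ε) (congrFun hfsT y)
    have h2 := birkhoffSum_sub T f (fun x => fs x + ε) n x
    rw [birkhoffSum_of_comp_eq h1, Pi.smul_apply, nsmul_eq_mul] at h2
    exact h2
  set E : Set M := {x | ∀ K : ℕ, ∃ n, (K : ℝ) < birkhoffSum T g n x} with hE
  have hsm : ∀ n, Measurable (birkhoffSum T g n) := fun n => by
    unfold birkhoffSum
    exact Finset.measurable_sum _ fun i _ => hgm.comp (hT.measurable.iterate i)
  have hEm : MeasurableSet E := by
    have : E = ⋂ K : ℕ, ⋃ n, {x | (K : ℝ) < birkhoffSum T g n x} := by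
      ext x; simp [hE]
    rw [this]
    exact MeasurableSet.iInter fun K => MeasurableSet.iUnion fun n =>
      measurableSet_lt measurable_const (hsm n)
  have hEinv : T ⁻¹' E = E := by
    ext x
    constructor
    · intro hx K
      obtain ⟨L, hL⟩ := exists_nat_ge (K - g x)
      obtain ⟨n, hn⟩ := hx L
      refine ⟨n + 1, ?_⟩
      rw [birkhoffSum_succ']
      linarith
    · intro hx K
      obtain ⟨L, hL⟩ := exists_nat_ge (K + g x)
      obtain ⟨n, hn⟩ := hx (max L 0)
      cases n with
      | zero => simp at hn; exact absurd hn (not_lt.2 (Nat.cast_nonneg _))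
      | succ n =>
        refine ⟨n, ?_⟩
        rw [birkhoffSum_succ'] at hn
        simp only [Nat.cast_max] at hn
        have := le_max_left (L : ℝ) ((0 : ℕ) : ℝ)
        linarith
  have hTE : MeasurePreserving T (μ.restrict E) (μ.restrict E) := by
    have := hT.restrict_preimage hEm
    rwa [hEinv] at this
  have hnonneg : 0 ≤ ∫ x in E, g x ∂μ :=
    integral_nonneg_of_exists_birkhoffSum_pos hTE hgi.integrableOn hgm <|
      (ae_restrict_iff' hEm).2 <| ae_of_all _ fun x hx => by simpa using hx 0
  have hint : ∫ x in E, g x ∂μ = -(ε * μ.real E) := by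
    have h1 : ∫ x in E, fs x ∂μ = ∫ x in E, f x ∂μ :=
      setIntegral_condExp hIle hf ⟨hEm, hEinv⟩
    have h2 : ∫ x in E, g x ∂μ = ∫ x in E, f x ∂μ - ∫ x in E, (fs x + ε) ∂μ :=
      integral_sub hf.integrableOn (integrable_condExp.add (integrable_const ε)).integrableOn
    have h3 : ∫ x in E, (fs x + ε) ∂μ = ∫ x in E, fs x ∂μ + ∫ x in E, ε ∂μ :=
      integral_add integrable_condExp.integrableOn (integrable_const ε).integrableOn
    rw [h2, h3, h1, setIntegral_const, smul_eq_mul]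
    ring
  have hE0 : μ E = 0 := by
    have h4 : μ.real E ≤ 0 := by
      by_contra! hc
      have := mul_pos hε hc
      linarith
    exact (measureReal_eq_zero_iff).1 (le_antisymm h4 measureReal_nonneg)
  filter_upwards [measure_eq_zero_iff_ae_notMem.1 hE0] with x hx
  simp only [hE, Set.mem_ofPred_eq, not_forall, not_exists, not_lt] at hx
  obtain ⟨K, hK⟩ := hx
  refine ⟨K, fun n => ?_⟩
  have := hK n
  rw [hsum] at this
  linarith

theorem ae_eventually_birkhoffAverage_lt [IsFiniteMeasure μ] (hT : MeasurePreserving T μ μ)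
    (hf : Integrable f μ) (hfm : Measurable f) :
    ∀ᵐ x ∂μ, ∀ c, (μ[f|MeasurableSpace.invariants T]) x < c →
      ∀ᶠ n in atTop, birkhoffAverage ℝ T f n x < c := by
  have h := ae_all_iff.2 fun m : ℕ =>
    ae_bddAbove_birkhoffSum_sub_condExp hT hf hfm (Nat.one_div_pos_of_nat (α := ℝ) (n := m))
  filter_upwards [h] with x hx c hc
  obtain ⟨m, hm⟩ := exists_nat_one_div_lt (sub_pos.2 hc)
  obtain ⟨K, hK⟩ := hx m
  have ht : Tendsto (fun n : ℕ => (μ[f|MeasurableSpace.invariants T]) x + 1 / ((m : ℝ) + 1)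
      + (K : ℝ) / n) atTop
      (𝓝 ((μ[f|MeasurableSpace.invariants T]) x + 1 / ((m : ℝ) + 1) + 0)) :=
    tendsto_const_nhds.add (tendsto_const_div_atTop_nhds_zero_nat _)
  filter_upwards [ht.eventually_lt_const (by linarith : _ < c), eventually_gt_atTop 0] with n hn hn0
  refine lt_of_le_of_lt ?_ hn
  have hn0' : (0 : ℝ) < n := by exact_mod_cast hn0
  rw [birkhoffAverage, smul_eq_mul, inv_mul_le_iff₀ hn0']
  refine (hK n).trans (le_of_eq ?_)
  field_simp

/-- Birkhoff's pointwise ergodic theorem for a measure preserving map of a finite measure space. -/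
theorem ae_tendsto_birkhoffAverage [IsFiniteMeasure μ] (hT : MeasurePreserving T μ μ)
    (hf : Integrable f μ) :
    ∀ᵐ x ∂μ, Tendsto (fun n => birkhoffAverage ℝ T f n x) atTop
      (𝓝 ((μ[f|MeasurableSpace.invariants T]) x)) := by
  obtain ⟨g, hgm, hfg⟩ := hf.aestronglyMeasurable
  have hg : Integrable g μ := hf.congr hfg
  have hav : ∀ᵐ x ∂μ, ∀ n, birkhoffAverage ℝ T f n x = birkhoffAverage ℝ T g n x :=
    ae_all_iff.2 fun n =>
      hT.quasiMeasurePreserving.birkhoffAverage_ae_eq_of_ae_eq ℝ hfg n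
  filter_upwards [hav, condExp_congr_ae (m := MeasurableSpace.invariants T) hfg,
    condExp_neg g (MeasurableSpace.invariants T) (μ := μ),
    ae_eventually_birkhoffAverage_lt hT hg hgm.measurable,
    ae_eventually_birkhoffAverage_lt hT hg.neg hgm.measurable.neg] with x h1 h2 h3 h4 h5
  simp only [h1, h2]
  -- The lower bound is the upper bound for −g.
  refine tendsto_order.2 ⟨fun c hc => ?_, h4⟩
  filter_upwards [h5 (-c) (by rw [h3]; simpa using hc)] with n hn
  rw [birkhoffAverage_neg] at hn
  simpa using hn

/-- The value f(Tⁿx) is the difference of consecutive Birkhoff sums, whose averages share a finite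
limit. -/
theorem ae_tendsto_orbit_div_zero [IsFiniteMeasure μ] (hT : MeasurePreserving T μ μ)
    (hf : Integrable f μ) :
    ∀ᵐ x ∂μ, Tendsto (fun n : ℕ => f (T^[n] x) / n) atTop (𝓝 0) := by
  filter_upwards [ae_tendsto_birkhoffAverage hT hf] with x hx
  set l := (μ[f|MeasurableSpace.invariants T]) x
  have h1 : Tendsto (fun n : ℕ => birkhoffAverage ℝ T f (n + 1) x * (1 + 1 / (n : ℝ)) -
      birkhoffAverage ℝ T f n x) atTop (𝓝 (l * (1 + 0) - l)) :=
    (((tendsto_add_atTop_iff_nat 1).2 hx).mul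
      (tendsto_const_nhds.add (tendsto_const_div_atTop_nhds_zero_nat 1))).sub hx
  rw [add_zero, mul_one, sub_self] at h1
  refine h1.congr' ?_
  filter_upwards [eventually_gt_atTop 0] with n hn
  have hn' : (0 : ℝ) < n := by exact_mod_cast hn
  simp only [birkhoffAverage, birkhoffSum_succ, smul_eq_mul, Nat.cast_add, Nat.cast_one]
  field_simp
  ring

end Birkhoff

/-! ### The cocycle along a single orbit -/

section Cocycle

variable {M : Type*} {φ : ℝ → M → M} {A B : M → Mat} {ω : M}

/-- The accumulated norm `∫_0^t ‖A(φ^s ω)‖ ds` of a generator along an orbit. -/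
noncomputable def energy (φ : ℝ → M → M) (A : M → Mat) (t : ℝ) (ω : M) : ℝ :=
  ∫ s in (0 : ℝ)..t, ‖A (φ s ω)‖

theorem exists_isCaratheodorySolution
    (h : LocallyIntegrable (fun s => A (φ s ω)) volume) :
    ∃ X : ℝ → Mat, IsCaratheodorySolution φ A ω X := by
  obtain ⟨X, hX, hX', -⟩ := exists_tendsto_picard h
  exact ⟨X, h, hX, hX'⟩

theorem IsCaratheodorySolution.eq {X Y : ℝ → Mat} (hX : IsCaratheodorySolution φ A ω X)
    (hY : IsCaratheodorySolution φ A ω Y) : X = Y :=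
  integral_equation_unique hX.locallyIntegrable hX.continuous hX.integral_eq hY.continuous
    hY.integral_eq

theorem isCaratheodorySolution_cocycle (h : LocallyIntegrable (fun s => A (φ s ω)) volume) :
    IsCaratheodorySolution φ A ω (fun t => cocycle φ A t ω) := by
  have h1 := exists_isCaratheodorySolution h
  have h2 : (fun t => cocycle φ A t ω) = h1.choose := by
    funext t
    simp only [cocycle, dif_pos h1]
  rw [h2]
  exact h1.choose_spec

/-- The cocycle is defined by a choice at each `ω`; uniqueness identifies it with the Picard limit,
which is what yields measurability in `ω`. -/
theorem tendsto_picard_cocycle (h : LocallyIntegrable (fun s => A (φ s ω)) volume) (t : ℝ) :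
    Tendsto (fun n => picard (fun s => A (φ s ω)) n t) atTop (𝓝 (cocycle φ A t ω)) := by
  obtain ⟨X, hX, hX', hlim⟩ := exists_tendsto_picard h
  have h1 : X = fun t => cocycle φ A t ω :=
    IsCaratheodorySolution.eq ⟨h, hX, hX'⟩ (isCaratheodorySolution_cocycle h)
  have := hlim t
  rwa [h1] at this

theorem cocycle_zero (h : LocallyIntegrable (fun s => A (φ s ω)) volume) :
    cocycle φ A 0 ω = 1 := by
  simpa using (isCaratheodorySolution_cocycle h).integral_eq 0

theorem norm_cocycle_le (h : LocallyIntegrable (fun s => A (φ s ω)) volume) (t : ℝ) :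
    ‖cocycle φ A t ω‖ ≤ Real.exp |energy φ A t ω| := by
  have h1 := isCaratheodorySolution_cocycle h
  simpa [energy] using norm_le_of_integral_equation h h1.continuous h1.integral_eq t

theorem energy_nonneg {t : ℝ} (ht : 0 ≤ t) : 0 ≤ energy φ A t ω :=
  intervalIntegral.integral_nonneg ht fun _ _ => norm_nonneg _

theorem energy_mono (h : LocallyIntegrable (fun s => A (φ s ω)) volume) {s t : ℝ} (hs : 0 ≤ s)
    (hst : s ≤ t) : energy φ A s ω ≤ energy φ A t ω :=
  intervalIntegral.integral_mono_interval le_rfl hs hst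
      (ae_of_all _ fun _ => norm_nonneg _) (h.norm_comp.intervalIntegrable 0 t)

section Flow

variable (hadd : ∀ t s, φ (t + s) = φ t ∘ φ s)
include hadd

theorem locallyIntegrable_orbit_shift (h : LocallyIntegrable (fun s => A (φ s ω)) volume)
    (t : ℝ) : LocallyIntegrable (fun s => A (φ s (φ t ω))) volume := by
  have := h.comp_add_real t
  simpa only [hadd, Function.comp_apply] using this

theorem energy_add (h : LocallyIntegrable (fun s => A (φ s ω)) volume) (t s : ℝ) :
    energy φ A (t + s) ω = energy φ A s ω + energy φ A t (φ s ω) := by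
  have h1 : energy φ A t (φ s ω) = ∫ r in s..(t + s), ‖A (φ r ω)‖ := by
    have := intervalIntegral.integral_comp_add_right (a := 0) (b := t)
      (fun r => ‖A (φ r ω)‖) s
    rw [zero_add] at this
    simpa only [energy, hadd, Function.comp_apply] using this
  rw [h1]
  exact (intervalIntegral.integral_add_adjacent_intervals
    (h.norm_comp.intervalIntegrable 0 s) (h.norm_comp.intervalIntegrable s (t + s))).symm

/-- As functions of t, both sides solve the equation along the orbit of φ^s ω with initial value
Φ_A(s, ω). -/
theorem cocycle_add (h : LocallyIntegrable (fun s => A (φ s ω)) volume) (t s : ℝ) :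
    cocycle φ A (t + s) ω = cocycle φ A t (φ s ω) * cocycle φ A s ω := by
  have h1 := isCaratheodorySolution_cocycle h
  have hs := locallyIntegrable_orbit_shift hadd h s
  have h2 := isCaratheodorySolution_cocycle hs
  have key := integral_equation_unique (x := cocycle φ A s ω)
    (X := fun t => cocycle φ A (t + s) ω)
    (Y := fun t => cocycle φ A t (φ s ω) * cocycle φ A s ω) hs
    (h1.continuous.comp (continuous_add_const s)) (fun t => ?_)
    (h2.continuous.mul continuous_const) (fun t => ?_)
  · exact congrFun key t
  · have h3 := intervalIntegral.integral_comp_add_right (a := 0) (b := t)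
      (fun r => A (φ r ω) * cocycle φ A r ω) s
    rw [zero_add] at h3
    simp only [hadd, Function.comp_apply] at h3
    have hi := h.mul_continuous h1.continuous
    rw [h3]
    have h4 := intervalIntegral.integral_add_adjacent_intervals
      (hi.intervalIntegrable 0 s) (hi.intervalIntegrable s (t + s))
    have h5 := h1.integral_eq (t + s)
    have h6 := h1.integral_eq s
    rw [h5, ← h4, ← add_assoc, ← h6]
  · have h3 := h2.integral_eq t
    have h4 := ((ContinuousLinearMap.mul ℝ Mat).flip (cocycle φ A s ω)).intervalIntegral_comp_comm
      ((hs.mul_continuous h2.continuous).intervalIntegrable 0 t)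
    simp only [ContinuousLinearMap.flip_apply, ContinuousLinearMap.mul_apply', mul_assoc] at h4
    rw [h4]
    conv_lhs => rw [h3]
    rw [add_mul, one_mul]

theorem cocycle_neg_mul_cocycle (h : LocallyIntegrable (fun s => A (φ s ω)) volume) (t : ℝ) :
    cocycle φ A (-t) (φ t ω) * cocycle φ A t ω = 1 := by
  rw [← cocycle_add hadd h, neg_add_cancel, cocycle_zero h]

/-- The inverse of Φ_A(t, ω) is Φ_A(−t, φ^t ω), whose norm is bounded by the exponential of the same
energy. -/
theorem exp_neg_energy_le_norm_cocycle (h : LocallyIntegrable (fun s => A (φ s ω)) volume)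
    {t : ℝ} (ht : 0 ≤ t) : Real.exp (-energy φ A t ω) ≤ ‖cocycle φ A t ω‖ := by
  have h1 := norm_mul_le (cocycle φ A (-t) (φ t ω)) (cocycle φ A t ω)
  rw [cocycle_neg_mul_cocycle hadd h, norm_one] at h1
  have h2 := norm_cocycle_le (locallyIntegrable_orbit_shift hadd h t) (-t)
  have h3 := energy_add hadd h (-t) t
  have h4 : energy φ A (-t) (φ t ω) = -energy φ A t ω := by
    rw [neg_add_cancel] at h3
    have : energy φ A 0 ω = 0 := intervalIntegral.integral_same
    linarith
  rw [h4, abs_neg, abs_of_nonneg (energy_nonneg ht)] at h2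
  have h5 : 1 ≤ Real.exp (energy φ A t ω) * ‖cocycle φ A t ω‖ :=
    h1.trans (by gcongr)
  rw [Real.exp_neg, inv_le_iff_one_le_mul₀' (Real.exp_pos _)]
  exact h5

theorem abs_log_norm_cocycle_le (h : LocallyIntegrable (fun s => A (φ s ω)) volume)
    {t : ℝ} (ht : 0 ≤ t) : |Real.log ‖cocycle φ A t ω‖| ≤ energy φ A t ω := by
  have h1 := exp_neg_energy_le_norm_cocycle hadd h ht
  have h2 := norm_cocycle_le h t
  rw [abs_of_nonneg (energy_nonneg ht)] at h2
  have h0 : 0 < ‖cocycle φ A t ω‖ := (Real.exp_pos _).trans_le h1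
  rw [abs_le]
  exact ⟨(Real.le_log_iff_exp_le h0).2 h1, (Real.log_le_iff_le_exp h0).2 h2⟩

theorem log_norm_cocycle_add_le (h : LocallyIntegrable (fun s => A (φ s ω)) volume) {t s : ℝ} (ht : 0 ≤ t) (hs : 0 ≤ s) :
    Real.log ‖cocycle φ A (t + s) ω‖ ≤
      Real.log ‖cocycle φ A s ω‖ + Real.log ‖cocycle φ A t (φ s ω)‖ := by
  have h0 : ∀ {t : ℝ} {ω : M}, LocallyIntegrable (fun s => A (φ s ω)) volume → 0 ≤ t →
      0 < ‖cocycle φ A t ω‖ := fun h ht =>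
    (Real.exp_pos _).trans_le (exp_neg_energy_le_norm_cocycle hadd h ht)
  have h1 := h0 h hs
  have h2 := h0 (locallyIntegrable_orbit_shift hadd h s) ht
  rw [← Real.log_mul h1.ne' h2.ne', mul_comm]
  refine Real.log_le_log (h0 h (by positivity)) ?_
  rw [cocycle_add hadd h]
  exact norm_mul_le _ _

/-- The factor ‖v‖ in ‖Φv‖ ≤ ‖Φ‖‖v‖ is lost after division by t. Conversely ‖Φ‖ is at most twice the
larger of its values on the two basis vectors, and the limsup of a maximum is the maximum of the
limsups. -/
theorem topExponent_eq_limsup (h : LocallyIntegrable (fun s => A (φ s ω)) volume) :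
    topExponent φ A ω =
      limsup (fun t : ℝ => ((Real.log ‖cocycle φ A t ω‖ / t : ℝ) : EReal)) atTop := by
  have hne : ∀ t, ∀ v : Plane, v ≠ 0 →
      Matrix.toEuclideanCLM (𝕜 := ℝ) (cocycle φ A t ω) v ≠ 0 := by
    intro t v hv h0
    apply hv
    have : Matrix.toEuclideanCLM (𝕜 := ℝ)
        (cocycle φ A (-t) (φ t ω) * cocycle φ A t ω) v = 0 := by
      rw [map_mul, mul_apply_eq_comp, h0, map_zero]
    rwa [cocycle_neg_mul_cocycle hadd h, map_one] at this
  apply le_antisymm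
  · refine iSup₂_le fun v hv => ?_
    have h1 : Tendsto (fun t : ℝ => ((Real.log ‖v‖ / t : ℝ) : EReal)) atTop (𝓝 0) := by
      have : Tendsto (fun t : ℝ => Real.log ‖v‖ / t) atTop (𝓝 0) :=
        tendsto_const_nhds.div_atTop tendsto_id
      exact_mod_cast (continuous_coe_real_ereal.tendsto 0).comp this
    have h2 := EReal.limsup_add_le (f := atTop)
      (u := fun t : ℝ => ((Real.log ‖cocycle φ A t ω‖ / t : ℝ) : EReal))
      (v := fun t : ℝ => ((Real.log ‖v‖ / t : ℝ) : EReal))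
      (by right; rw [h1.limsup_eq]; simp) (by right; rw [h1.limsup_eq]; simp)
    rw [h1.limsup_eq, add_zero] at h2
    refine le_trans (limsup_le_limsup ?_) h2
    filter_upwards [eventually_gt_atTop 0] with t ht
    simp only [Pi.add_apply]
    rw [← EReal.coe_add, EReal.coe_le_coe_iff, ← add_div]
    gcongr
    have h3 := (Matrix.toEuclideanCLM (𝕜 := ℝ) (cocycle φ A t ω)).le_opNorm v
    change _ ≤ ‖cocycle φ A t ω‖ * _ at h3
    have h4 : 0 < ‖cocycle φ A t ω‖ := by
      by_contra! hc
      have h5 : ‖cocycle φ A t ω‖ = 0 := le_antisymm hc (norm_nonneg _)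
      rw [h5, zero_mul] at h3
      exact hne t v hv (norm_le_zero_iff.1 h3)
    rw [← Real.log_mul h4.ne' (norm_ne_zero_iff.2 hv)]
    exact Real.log_le_log (norm_pos_iff.2 (hne t v hv)) h3
  · set e : Fin 2 → Plane := fun i => EuclideanSpace.single i 1 with he
    have he0 : ∀ i, e i ≠ 0 := fun i => by simp [he]
    set m : ℝ → ℝ := fun t => max
      (Real.log ‖Matrix.toEuclideanCLM (𝕜 := ℝ) (cocycle φ A t ω) (e 0)‖ / t)
      (Real.log ‖Matrix.toEuclideanCLM (𝕜 := ℝ) (cocycle φ A t ω) (e 1)‖ / t) with hm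
    have h1 : Tendsto (fun t : ℝ => ((Real.log 2 / t : ℝ) : EReal)) atTop (𝓝 0) := by
      have : Tendsto (fun t : ℝ => Real.log 2 / t) atTop (𝓝 0) :=
        tendsto_const_nhds.div_atTop tendsto_id
      exact_mod_cast (continuous_coe_real_ereal.tendsto 0).comp this
    have h2 := EReal.limsup_add_le (f := atTop)
      (u := fun t : ℝ => ((m t : ℝ) : EReal))
      (v := fun t : ℝ => ((Real.log 2 / t : ℝ) : EReal))
      (by right; rw [h1.limsup_eq]; simp) (by right; rw [h1.limsup_eq]; simp)
    rw [h1.limsup_eq, add_zero] at h2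
    have h3 : limsup (fun t : ℝ => ((m t : ℝ) : EReal)) atTop ≤ topExponent φ A ω := by
      have : (fun t : ℝ => ((m t : ℝ) : EReal)) = fun t => max
          ((Real.log ‖Matrix.toEuclideanCLM (𝕜 := ℝ) (cocycle φ A t ω) (e 0)‖ / t : ℝ) : EReal)
          ((Real.log ‖Matrix.toEuclideanCLM (𝕜 := ℝ) (cocycle φ A t ω) (e 1)‖ / t : ℝ) : EReal) :=
        funext fun t => EReal.coe_strictMono.monotone.map_max
      rw [this, limsup_max]
      exact max_le (le_iSup₂_of_le (e 0) (he0 0) le_rfl) (le_iSup₂_of_le (e 1) (he0 1) le_rfl)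
    refine le_trans (limsup_le_limsup ?_) (h2.trans h3)
    filter_upwards [eventually_gt_atTop 0] with t ht
    simp only [Pi.add_apply]
    rw [← EReal.coe_add, EReal.coe_le_coe_iff]
    set L := Matrix.toEuclideanCLM (𝕜 := ℝ) (cocycle φ A t ω) with hL
    have hmax : m t = Real.log (max ‖L (e 0)‖ ‖L (e 1)‖) / t := by
      have hp0 := norm_pos_iff.2 (hne t _ (he0 0))
      have hp1 := norm_pos_iff.2 (hne t _ (he0 1))
      rcases le_total ‖L (e 0)‖ ‖L (e 1)‖ with hc | hc
      · rw [max_eq_right hc]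
        exact max_eq_right (by gcongr)
      · rw [max_eq_left hc]
        exact max_eq_left (by gcongr)
    have hpos : 0 < max ‖L (e 0)‖ ‖L (e 1)‖ :=
      lt_max_of_lt_left (norm_pos_iff.2 (hne t _ (he0 0)))
    rw [hmax, ← add_div, ← Real.log_mul hpos.ne' two_ne_zero]
    have hbound : ‖cocycle φ A t ω‖ ≤ max ‖L (e 0)‖ ‖L (e 1)‖ * 2 := by
      rw [Matrix.l2_opNorm_def]
      refine ContinuousLinearMap.opNorm_le_bound _ (by positivity) fun v => ?_
      have hv : v = v 0 • e 0 + v 1 • e 1 := by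
        ext i
        fin_cases i <;> simp [he]
      have hvi : ∀ i, ‖v i‖ ≤ ‖v‖ := fun i => PiLp.norm_apply_le v i
      have hLv : L v = v 0 • L (e 0) + v 1 • L (e 1) := by
        conv_lhs => rw [hv]
        simp only [map_add, map_smul]
      change ‖L v‖ ≤ _
      calc ‖L v‖ ≤ ‖v 0‖ * ‖L (e 0)‖ + ‖v 1‖ * ‖L (e 1)‖ := by
            rw [hLv, ← norm_smul, ← norm_smul]; exact norm_add_le _ _
        _ ≤ ‖v‖ * max ‖L (e 0)‖ ‖L (e 1)‖ + ‖v‖ * max ‖L (e 0)‖ ‖L (e 1)‖ := by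
            gcongr
            · exact hvi 0
            · exact le_max_left _ _
            · exact hvi 1
            · exact le_max_right _ _
        _ = _ := by ring
    have hpos' : 0 < ‖cocycle φ A t ω‖ := by
      refine norm_pos_iff.2 fun h0 => hne t _ (he0 0) ?_
      rw [h0, map_zero]; rfl
    gcongr

end Flow

end Cocycle

/-! ### Integrating over orbit segments -/

section FlowIntegrals

variable {M : Type*} [MeasurableSpace M] {μ : Measure M} {φ : ℝ → M → M}
  {E : Type*} [NormedAddCommGroup E]

theorem IsMeasurePreservingFlow.stronglyMeasurable_comp (hφ : IsMeasurePreservingFlow μ φ)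
    {f : M → E} (hf : StronglyMeasurable f) :
    StronglyMeasurable fun p : M × ℝ => f (φ p.2 p.1) :=
  hf.comp_measurable (hφ.measurable_uncurry.comp measurable_swap)

theorem IsMeasurePreservingFlow.iterate (hφ : IsMeasurePreservingFlow μ φ) (t : ℝ) (k : ℕ) :
    (φ t)^[k] = φ (k * t) := by
  induction k with
  | zero => simp [hφ.map_zero]
  | succ k ih =>
    rw [Function.iterate_succ, ih, ← hφ.map_add]
    congr 1
    push_cast
    ring

theorem IsMeasurePreservingFlow.integral_comp [NormedSpace ℝ E] (hφ : IsMeasurePreservingFlow μ φ)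
    {f : M → E} (hf : AEStronglyMeasurable f μ) (t : ℝ) :
    ∫ ω, f (φ t ω) ∂μ = ∫ ω, f ω ∂μ := by
  have := integral_map (hφ.measurePreserving t).measurable.aemeasurable (f := f) (μ := μ)
    (by rwa [(hφ.measurePreserving t).map_eq])
  rw [← this, (hφ.measurePreserving t).map_eq]

variable [SFinite μ]

/-- By invariance all time slices have the same L¹ norm, which is therefore integrable against a
finite measure in time. -/
theorem IsMeasurePreservingFlow.integrable_prod (hφ : IsMeasurePreservingFlow μ φ)
    {f : M → E} (hf : StronglyMeasurable f) (hfi : Integrable f μ) (ν : Measure ℝ)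
    [IsFiniteMeasure ν] : Integrable (fun p : M × ℝ => f (φ p.2 p.1)) (μ.prod ν) := by
  rw [integrable_prod_iff' (hφ.stronglyMeasurable_comp hf).aestronglyMeasurable]
  refine ⟨ae_of_all _ fun t => (hφ.measurePreserving t).integrable_comp_of_integrable hfi, ?_⟩
  have : (fun t : ℝ => ∫ ω, ‖f (φ t ω)‖ ∂μ) = fun _ => ∫ ω, ‖f ω‖ ∂μ :=
    funext fun t => hφ.integral_comp (f := fun ω => ‖f ω‖) hf.norm.aestronglyMeasurable t
  rw [this]
  exact integrable_const _

theorem IsMeasurePreservingFlow.ae_locallyIntegrable (hφ : IsMeasurePreservingFlow μ φ)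
    {f : M → E} (hf : StronglyMeasurable f) (hfi : Integrable f μ) :
    ∀ᵐ ω ∂μ, LocallyIntegrable (fun s => f (φ s ω)) volume := by
  have h : ∀ n : ℕ, ∀ᵐ ω ∂μ, Integrable (fun s => f (φ s ω))
      (volume.restrict (Set.Ioc (-n : ℝ) n)) := fun n =>
    (hφ.integrable_prod hf hfi (volume.restrict (Set.Ioc (-n : ℝ) n))).prod_right_ae
  filter_upwards [ae_all_iff.2 h] with ω hω x
  obtain ⟨n, hn⟩ := exists_nat_gt |x|
  rw [abs_lt] at hn
  exact ⟨Set.Ioc (-n : ℝ) n, Ioc_mem_nhds hn.1 hn.2, hω n⟩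

theorem IsMeasurePreservingFlow.integrable_intervalIntegral [NormedSpace ℝ E]
    (hφ : IsMeasurePreservingFlow μ φ)
    {f : M → E} (hf : StronglyMeasurable f) (hfi : Integrable f μ) {t : ℝ} (ht : 0 ≤ t) :
    Integrable (fun ω => ∫ s in (0 : ℝ)..t, f (φ s ω)) μ := by
  simp only [intervalIntegral.integral_of_le ht]
  exact (hφ.integrable_prod hf hfi (volume.restrict (Set.Ioc 0 t))).integral_prod_left

theorem IsMeasurePreservingFlow.integral_intervalIntegral [NormedSpace ℝ E] [CompleteSpace E]
    (hφ : IsMeasurePreservingFlow μ φ)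
    {f : M → E} (hf : StronglyMeasurable f) (hfi : Integrable f μ) {t : ℝ} (ht : 0 ≤ t) :
    ∫ ω, (∫ s in (0 : ℝ)..t, f (φ s ω)) ∂μ = t • ∫ ω, f ω ∂μ := by
  simp only [intervalIntegral.integral_of_le ht]
  rw [integral_integral_swap (hφ.integrable_prod hf hfi (volume.restrict (Set.Ioc 0 t)))]
  simp only [hφ.integral_comp hfi.aestronglyMeasurable]
  rw [setIntegral_const]
  simp [ht]

end FlowIntegrals

/-! ### Measurability of the cocycle -/

section CocycleMeasurability

variable {M : Type*} [MeasurableSpace M] {μ : Measure M} {φ : ℝ → M → M} {A : M → Mat}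

theorem stronglyMeasurable_picard (hφ : IsMeasurePreservingFlow μ φ) (hA : StronglyMeasurable A)
    (n : ℕ) : StronglyMeasurable fun p : M × ℝ => picard (fun s => A (φ s p.1)) n p.2 := by
  induction n with
  | zero => exact stronglyMeasurable_const
  | succ n ih =>
    have hint : StronglyMeasurable fun q : (M × ℝ) × ℝ =>
        A (φ q.2 q.1.1) * picard (fun s => A (φ s q.1.1)) n q.2 := by
      have hm : Measurable fun q : (M × ℝ) × ℝ => (q.1.1, q.2) := by fun_prop
      exact ((hφ.stronglyMeasurable_comp hA).comp_measurable hm).mul (ih.comp_measurable hm)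
    -- An interval integral is the difference of the integrals over (0, t] and (t, 0]. For each, the
    -- moving domain becomes an indicator on the product space.
    have key : ∀ l u : ℝ → ℝ, Measurable l → Measurable u →
        StronglyMeasurable fun p : M × ℝ => ∫ s in Set.Ioc (l p.2) (u p.2),
          A (φ s p.1) * picard (fun s => A (φ s p.1)) n s := by
      intro l u hl hu
      have hset : MeasurableSet {q : (M × ℝ) × ℝ | q.2 ∈ Set.Ioc (l q.1.2) (u q.1.2)} := by
        refine (measurableSet_lt (hl.comp (by fun_prop)) measurable_snd).inter
          (measurableSet_le measurable_snd (hu.comp (by fun_prop)))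
      have := (hint.indicator hset).integral_prod_right' (ν := volume)
      refine (congrArg StronglyMeasurable (funext fun p => ?_)).mp this
      rw [← integral_indicator measurableSet_Ioc]
      rfl
    have h1 := key (fun _ => 0) id measurable_const measurable_id
    have h2 := key id (fun _ => 0) measurable_id measurable_const
    exact stronglyMeasurable_const.add (h1.sub h2)

theorem aestronglyMeasurable_cocycle [SFinite μ] (hφ : IsMeasurePreservingFlow μ φ)
    (hA : StronglyMeasurable A) (hAi : Integrable A μ) (t : ℝ) :
    AEStronglyMeasurable (cocycle φ A t) μ := by
  refine aestronglyMeasurable_of_tendsto_ae atTop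
    (f := fun n ω => picard (fun s => A (φ s ω)) n t) (fun n => ?_) ?_
  · exact ((stronglyMeasurable_picard hφ hA n).comp_measurable
      (measurable_id.prodMk measurable_const)).aestronglyMeasurable
  · filter_upwards [hφ.ae_locallyIntegrable hA hAi] with ω hω
    exact tendsto_picard_cocycle hω t

end CocycleMeasurability

/-- The upper growth rate of a real function is already attained along an arithmetic progression,
if the function does not rise too much in between. -/
theorem limsup_div_le_limsup_nat {h : ℝ → ℝ} {c : ℕ → ℝ} {N C : ℝ} (hN : 0 < N)
    (hC : ∀ k : ℕ, |h (k * N)| ≤ C * k) (hc : Tendsto (fun k : ℕ => c k / k) atTop (𝓝 0))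
    (hle : ∀ (k : ℕ) (t : ℝ), k * N ≤ t → t ≤ (k + 1) * N → h t ≤ h (k * N) + c k) :
    limsup (fun t : ℝ => ((h t / t : ℝ) : EReal)) atTop ≤
      limsup (fun k : ℕ => ((h (k * N) / (k * N) : ℝ) : EReal)) atTop := by
  set κ : ℝ → ℕ := fun t => ⌊t / N⌋₊ with hκ
  have hdiv : Tendsto (fun t : ℝ => t / N) atTop atTop := tendsto_id.atTop_div_const hN
  have hκt : Tendsto κ atTop atTop := tendsto_nat_floor_atTop.comp hdiv
  have hratio : Tendsto (fun t : ℝ => (κ t : ℝ) / (t / N)) atTop (𝓝 1) :=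
    tendsto_nat_floor_div_atTop.comp hdiv
  -- The exact error in replacing h(t)/t, after h(t) ≤ h(κN) + c(κ), by h(κN)/(κN). It vanishes
  -- because κN/t tends to 1, h(κN)/(κN) is bounded and c(k)/k tends to 0.
  set e : ℝ → ℝ := fun t => h (κ t * N) / (κ t * N) * ((κ t : ℝ) / (t / N) - 1) +
    c (κ t) / κ t * ((κ t : ℝ) / (t / N) * N⁻¹) with he
  have he0 : Tendsto e atTop (𝓝 0) := by
    have h1 : Tendsto (fun t => h (κ t * N) / (κ t * N) * ((κ t : ℝ) / (t / N) - 1)) atTop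
        (𝓝 0) := by
      have h2 : Tendsto (fun t => C / N * |(κ t : ℝ) / (t / N) - 1|) atTop (𝓝 (C / N * |1 - 1|)) :=
        ((hratio.sub_const 1).abs).const_mul _
      rw [sub_self, abs_zero, mul_zero] at h2
      refine squeeze_zero_norm' ?_ h2
      filter_upwards [hκt.eventually_gt_atTop 0] with t ht
      have ht' : (0 : ℝ) < κ t := by exact_mod_cast ht
      rw [norm_mul, Real.norm_eq_abs, Real.norm_eq_abs]
      gcongr
      rw [abs_div, abs_of_pos (by positivity : 0 < (κ t : ℝ) * N), div_le_div_iff₀ (by positivity) hN]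
      have := hC (κ t)
      nlinarith
    have h3 : Tendsto (fun t => c (κ t) / κ t * ((κ t : ℝ) / (t / N) * N⁻¹)) atTop
        (𝓝 (0 * (1 * N⁻¹))) := (hc.comp hκt).mul (hratio.mul_const _)
    simpa using h1.add h3
  have he0' : Tendsto (fun t => ((e t : ℝ) : EReal)) atTop (𝓝 0) := by
    exact_mod_cast (continuous_coe_real_ereal.tendsto 0).comp he0
  have hadd := EReal.limsup_add_le (f := atTop)
    (u := fun t : ℝ => ((h (κ t * N) / (κ t * N) : ℝ) : EReal))
    (v := fun t : ℝ => ((e t : ℝ) : EReal))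
    (by right; rw [he0'.limsup_eq]; simp) (by right; rw [he0'.limsup_eq]; simp)
  rw [he0'.limsup_eq, add_zero] at hadd
  have hcomp : limsup (fun t : ℝ => ((h (κ t * N) / (κ t * N) : ℝ) : EReal)) atTop ≤
      limsup (fun k : ℕ => ((h (k * N) / (k * N) : ℝ) : EReal)) atTop := by
    change limsup ((fun k : ℕ => ((h (k * N) / (k * N) : ℝ) : EReal)) ∘ κ) atTop ≤ _
    rw [limsup_comp]
    exact limsup_le_limsup_of_le hκt
  refine le_trans (limsup_le_limsup ?_) (hadd.trans hcomp)
  filter_upwards [hκt.eventually_gt_atTop 0, eventually_gt_atTop 0] with t ht ht0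
  have ht' : (0 : ℝ) < κ t := by exact_mod_cast ht
  simp only [Pi.add_apply]
  rw [← EReal.coe_add, EReal.coe_le_coe_iff]
  have h1 : (κ t : ℝ) * N ≤ t := by
    rw [← le_div_iff₀ hN]; exact Nat.floor_le (by positivity)
  have h2 : t ≤ (κ t + 1) * N := by
    rw [← div_le_iff₀ hN]; exact (Nat.lt_floor_add_one _).le
  calc h t / t ≤ (h (κ t * N) + c (κ t)) / t := by gcongr; exact hle _ _ h1 h2
    _ = _ := by
      simp only [he]
      field_simp
      ring

/-! ### Integrability and finite-time approximation of the top exponent -/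

section TopExponent

variable {M : Type*} [MeasurableSpace M] {μ : Measure M} {φ : ℝ → M → M} {A : M → Mat}

/-- The logarithmic growth `log ‖Φ_A(t, ω)‖`. -/
noncomputable def logNorm (φ : ℝ → M → M) (A : M → Mat) (t : ℝ) (ω : M) : ℝ :=
  Real.log ‖cocycle φ A t ω‖

theorem energy_nat_mul (hφ : IsMeasurePreservingFlow μ φ) {ω : M}
    (h : LocallyIntegrable (fun s => A (φ s ω)) volume) (N : ℝ) (k : ℕ) :
    energy φ A (k * N) ω = birkhoffSum (φ N) (energy φ A N) k ω := by
  induction k with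
  | zero => simp [energy]
  | succ k ih =>
    rw [birkhoffSum_succ, ← ih, hφ.iterate, ← energy_add hφ.map_add h]
    congr 1
    push_cast
    ring

theorem logNorm_nat_mul_le (hφ : IsMeasurePreservingFlow μ φ) {ω : M}
    (h : LocallyIntegrable (fun s => A (φ s ω)) volume) {N : ℝ} (hN : 0 ≤ N) (k : ℕ) :
    logNorm φ A (k * N) ω ≤ birkhoffSum (φ N) (logNorm φ A N) k ω := by
  induction k with
  | zero => simp [logNorm, cocycle_zero h]
  | succ k ih =>
    rw [birkhoffSum_succ, hφ.iterate]
    have := log_norm_cocycle_add_le hφ.map_add h hN (s := k * N) (by positivity)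
    have h2 : ((k + 1 : ℕ) : ℝ) * N = N + k * N := by push_cast; ring
    rw [h2]
    exact this.trans (add_le_add ih le_rfl)

theorem integrable_energy [SFinite μ] (hφ : IsMeasurePreservingFlow μ φ)
    (hA : StronglyMeasurable A) (hAi : Integrable A μ) {t : ℝ} (ht : 0 ≤ t) :
    Integrable (energy φ A t) μ :=
  hφ.integrable_intervalIntegral hA.norm hAi.norm ht

theorem integrable_logNorm [SFinite μ] (hφ : IsMeasurePreservingFlow μ φ)
    (hA : StronglyMeasurable A) (hAi : Integrable A μ) {t : ℝ} (ht : 0 ≤ t) :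
    Integrable (logNorm φ A t) μ := by
  refine (integrable_energy hφ hA hAi ht).mono' ?_ ?_
  · exact (Real.measurable_log.comp_aemeasurable
      (aestronglyMeasurable_cocycle hφ hA hAi t).norm.aemeasurable).aestronglyMeasurable
  · filter_upwards [hφ.ae_locallyIntegrable hA hAi] with ω hω
    exact abs_log_norm_cocycle_le hφ.map_add hω ht

variable [IsFiniteMeasure μ]

/-- Between kN and (k+1)N the log norm rises by at most the energy of time N at φ^{kN} ω, which is
o(k) almost everywhere; convergent Birkhoff averages of the energy supply the linear bound. -/
theorem ae_topExponent_eq_limsup_nat (hφ : IsMeasurePreservingFlow μ φ)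
    (hA : StronglyMeasurable A) (hAi : Integrable A μ) {N : ℝ} (hN : 0 < N) :
    ∀ᵐ ω ∂μ, topExponent φ A ω =
      limsup (fun k : ℕ => ((logNorm φ A (k * N) ω / (k * N) : ℝ) : EReal)) atTop := by
  have hE := integrable_energy hφ hA hAi hN.le
  filter_upwards [hφ.ae_locallyIntegrable hA hAi,
    ae_tendsto_birkhoffAverage (hφ.measurePreserving N) hE,
    ae_tendsto_orbit_div_zero (hφ.measurePreserving N) hE] with ω h h1 h2
  rw [topExponent_eq_limsup hφ.map_add h]
  apply le_antisymm
  · obtain ⟨C, hC⟩ := h1.bddAbove_range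
    refine limsup_div_le_limsup_nat (h := fun t => logNorm φ A t ω) (C := C) hN (fun k => ?_) h2
      (fun k t hkt htk => ?_)
    · have h3 : |logNorm φ A (k * N) ω| ≤ energy φ A (k * N) ω :=
        abs_log_norm_cocycle_le hφ.map_add h (by positivity)
      refine h3.trans ?_
      rw [energy_nat_mul hφ h]
      rcases Nat.eq_zero_or_pos k with rfl | hk
      · simp
      · have h4 : birkhoffAverage ℝ (φ N) (energy φ A N) k ω ≤ C := hC ⟨k, rfl⟩
        have hk' : (0 : ℝ) < k := by exact_mod_cast hk
        rw [birkhoffAverage, smul_eq_mul, inv_mul_le_iff₀ hk'] at h4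
        linarith
    · have hk0 : 0 ≤ t - k * N := by linarith
      have h3 := log_norm_cocycle_add_le hφ.map_add h hk0 (s := k * N) (by positivity)
      rw [sub_add_cancel] at h3
      refine h3.trans ?_
      have hs := locallyIntegrable_orbit_shift hφ.map_add h (k * N)
      rw [hφ.iterate]
      gcongr
      · exact le_rfl
      · exact ((le_abs_self _).trans (abs_log_norm_cocycle_le hφ.map_add hs hk0)).trans
          (energy_mono hs hk0 (by linarith))
  · have ht : Tendsto (fun k : ℕ => (k : ℝ) * N) atTop atTop :=
      tendsto_natCast_atTop_atTop.atTop_mul_const hN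
    change limsup ((fun t : ℝ => ((Real.log ‖cocycle φ A t ω‖ / t : ℝ) : EReal)) ∘
      fun k : ℕ => (k : ℝ) * N) atTop ≤ _
    rw [limsup_comp]
    exact limsup_le_limsup_of_le ht

/-- Subadditivity bounds the log norm at time kN by a Birkhoff sum for φ^N. Its limit depends on the
σ-algebra of φ^N-invariant sets, but that dependence disappears on integration. -/
theorem ae_topExponent_le_condExp (hφ : IsMeasurePreservingFlow μ φ)
    (hA : StronglyMeasurable A) (hAi : Integrable A μ) {N : ℝ} (hN : 0 < N) :
    ∀ᵐ ω ∂μ, topExponent φ A ω ≤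
      (((μ[logNorm φ A N|MeasurableSpace.invariants (φ N)]) ω / N : ℝ) : EReal) := by
  filter_upwards [hφ.ae_locallyIntegrable hA hAi, ae_topExponent_eq_limsup_nat hφ hA hAi hN,
    ae_tendsto_birkhoffAverage (hφ.measurePreserving N) (integrable_logNorm hφ hA hAi hN.le)]
    with ω h h1 h2
  have h3 := (continuous_coe_real_ereal.tendsto _).comp (h2.div_const N)
  rw [h1, ← h3.limsup_eq]
  refine limsup_le_limsup (Eventually.of_forall fun k => ?_)
  simp only [Function.comp_apply, EReal.coe_le_coe_iff, birkhoffAverage, smul_eq_mul]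
  rw [← div_eq_inv_mul, div_div]
  gcongr
  exact logNorm_nat_mul_le hφ h hN.le k

theorem ae_neg_condExp_le_topExponent (hφ : IsMeasurePreservingFlow μ φ)
    (hA : StronglyMeasurable A) (hAi : Integrable A μ) :
    ∀ᵐ ω ∂μ, ((-(μ[energy φ A 1|MeasurableSpace.invariants (φ 1)]) ω : ℝ) : EReal) ≤
      topExponent φ A ω := by
  filter_upwards [hφ.ae_locallyIntegrable hA hAi,
    ae_topExponent_eq_limsup_nat hφ hA hAi one_pos,
    ae_tendsto_birkhoffAverage (hφ.measurePreserving 1) (integrable_energy hφ hA hAi zero_le_one)]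
    with ω h h1 h2
  have h3 := (continuous_coe_real_ereal.tendsto _).comp h2.neg
  rw [h1, ← h3.limsup_eq]
  refine limsup_le_limsup (Eventually.of_forall fun k => ?_)
  simp only [Function.comp_apply, EReal.coe_le_coe_iff, birkhoffAverage, smul_eq_mul]
  rw [← div_eq_inv_mul, ← neg_div, ← energy_nat_mul hφ h, mul_one]
  gcongr
  exact (abs_le.1 (abs_log_norm_cocycle_le hφ.map_add h (Nat.cast_nonneg k))).1

theorem ae_topExponent_finite (hφ : IsMeasurePreservingFlow μ φ)
    (hA : StronglyMeasurable A) (hAi : Integrable A μ) :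
    ∀ᵐ ω ∂μ, topExponent φ A ω ≠ ⊥ ∧ topExponent φ A ω ≠ ⊤ := by
  filter_upwards [ae_topExponent_le_condExp hφ hA hAi one_pos,
    ae_neg_condExp_le_topExponent hφ hA hAi] with ω h1 h2
  exact ⟨ne_bot_of_le_ne_bot (EReal.coe_ne_bot _) h2, ne_top_of_le_ne_top (EReal.coe_ne_top _) h1⟩

theorem aemeasurable_topExponent (hφ : IsMeasurePreservingFlow μ φ)
    (hA : StronglyMeasurable A) (hAi : Integrable A μ) : AEMeasurable (topExponent φ A) μ := by
  have hm : ∀ k : ℕ, AEMeasurable (logNorm φ A (k * 1)) μ := fun k =>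
    (integrable_logNorm hφ hA hAi (by positivity)).aestronglyMeasurable.aemeasurable
  refine ⟨fun ω => limsup (fun k : ℕ => (((hm k).mk _ ω / (k * 1) : ℝ) : EReal)) atTop,
    Measurable.limsup fun k => ((hm k).measurable_mk.div_const _).coe_real_ereal, ?_⟩
  filter_upwards [ae_topExponent_eq_limsup_nat hφ hA hAi one_pos,
    ae_all_iff.2 fun k => (hm k).ae_eq_mk] with ω h1 h2
  rw [h1]
  simp only [h2]

theorem integrable_topExponent (hφ : IsMeasurePreservingFlow μ φ)
    (hA : StronglyMeasurable A) (hAi : Integrable A μ) :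
    Integrable (fun ω => (topExponent φ A ω).toReal) μ := by
  refine Integrable.mono' (g := fun ω => |(μ[energy φ A 1|MeasurableSpace.invariants (φ 1)]) ω| +
      |(μ[logNorm φ A 1|MeasurableSpace.invariants (φ 1)]) ω|)
    (integrable_condExp.abs.add integrable_condExp.abs)
    (measurable_ereal_toReal.comp_aemeasurable
      (aemeasurable_topExponent hφ hA hAi)).aestronglyMeasurable ?_
  filter_upwards [ae_topExponent_le_condExp hφ hA hAi one_pos,
    ae_neg_condExp_le_topExponent hφ hA hAi, ae_topExponent_finite hφ hA hAi] with ω h1 h2 h3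
  lift topExponent φ A ω to ℝ using ⟨h3.2, h3.1⟩ with l
  rw [div_one, EReal.coe_le_coe_iff] at h1
  rw [EReal.coe_le_coe_iff] at h2
  rw [EReal.toReal_coe, Real.norm_eq_abs, abs_le]
  constructor
  · have := neg_abs_le ((μ[logNorm φ A 1|MeasurableSpace.invariants (φ 1)]) ω)
    have := le_abs_self ((μ[energy φ A 1|MeasurableSpace.invariants (φ 1)]) ω)
    linarith [abs_nonneg ((μ[logNorm φ A 1|MeasurableSpace.invariants (φ 1)]) ω)]
  · have := le_abs_self ((μ[logNorm φ A 1|MeasurableSpace.invariants (φ 1)]) ω)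
    linarith [abs_nonneg ((μ[energy φ A 1|MeasurableSpace.invariants (φ 1)]) ω)]

theorem integratedTopExponent_le (hφ : IsMeasurePreservingFlow μ φ)
    (hA : StronglyMeasurable A) (hAi : Integrable A μ) {N : ℝ} (hN : 0 < N) :
    integratedTopExponent μ φ A ≤ (∫ ω, logNorm φ A N ω ∂μ) / N := by
  rw [← integral_condExp (MeasurableSpace.invariants_le (φ N)), ← integral_div]
  refine integral_mono_ae (integrable_topExponent hφ hA hAi) (integrable_condExp.div_const N) ?_
  filter_upwards [ae_topExponent_le_condExp hφ hA hAi hN, ae_topExponent_finite hφ hA hAi]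
    with ω h1 h3
  lift topExponent φ A ω to ℝ using ⟨h3.2, h3.1⟩ with l
  exact EReal.coe_le_coe_iff.1 h1

/-- The integrated growth over some finite time comes arbitrarily close to the integrated top
exponent. -/
theorem exists_integral_logNorm_lt (hφ : IsMeasurePreservingFlow μ φ)
    (hA : StronglyMeasurable A) (hAi : Integrable A μ) {ε : ℝ} (hε : 0 < ε) :
    ∃ n : ℕ, 0 < n ∧
      (∫ ω, logNorm φ A n ω ∂μ) / n < integratedTopExponent μ φ A + ε := by
  -- If every time average of the integrated log norm were at least L(A) + ε, then ∫ w_n ≤ ∫‖A‖ −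
  -- L(A) − ε for all n. Pointwise, liminf w_n ≥ G − λ₁, whose integral is ∫‖A‖ − L(A), and Fatou's
  -- lemma gives a contradiction. Adding the energy makes w_n nonnegative; the index n + 1 avoids
  -- time 0.
  by_contra! hcon
  set G := μ[energy φ A 1|MeasurableSpace.invariants (φ 1)] with hG
  have hEi := integrable_energy hφ hA hAi zero_le_one
  set w : ℕ → M → ℝ := fun n ω =>
    (energy φ A (n + 1 : ℕ) ω - logNorm φ A (n + 1 : ℕ) ω) / (n + 1 : ℕ) with hw
  have hwi : ∀ n, Integrable (w n) μ := fun n =>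
    ((integrable_energy hφ hA hAi (Nat.cast_nonneg _)).sub
      (integrable_logNorm hφ hA hAi (Nat.cast_nonneg _))).div_const _
  have hw0 : ∀ n, 0 ≤ᵐ[μ] w n := fun n => by
    filter_upwards [hφ.ae_locallyIntegrable hA hAi] with ω h
    have := abs_log_norm_cocycle_le hφ.map_add h (Nat.cast_nonneg (n + 1))
    exact div_nonneg (sub_nonneg.2 ((le_abs_self _).trans this)) (Nat.cast_nonneg _)
  have hint : ∀ n, ∫ ω, w n ω ∂μ ≤ ∫ ω, ‖A ω‖ ∂μ - (integratedTopExponent μ φ A + ε) := by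
    intro n
    have h1 := hcon (n + 1) n.succ_pos
    have hn : (0 : ℝ) < (n + 1 : ℕ) := by positivity
    have h2 : ∫ ω, energy φ A (n + 1 : ℕ) ω ∂μ = (n + 1 : ℕ) * ∫ ω, ‖A ω‖ ∂μ :=
      hφ.integral_intervalIntegral hA.norm hAi.norm (Nat.cast_nonneg _)
    rw [integral_div, integral_sub (integrable_energy hφ hA hAi (Nat.cast_nonneg _))
      (integrable_logNorm hφ hA hAi (Nat.cast_nonneg _)), h2, sub_div, mul_div_cancel_left₀ _ hn.ne']
    linarith
  have hGint : ∫ ω, G ω ∂μ = ∫ ω, ‖A ω‖ ∂μ := by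
    rw [hG, integral_condExp (MeasurableSpace.invariants_le _)]
    have := hφ.integral_intervalIntegral hA.norm hAi.norm zero_le_one
    rwa [one_smul] at this
  have hpt : ∀ᵐ ω ∂μ, ENNReal.ofReal (G ω - (topExponent φ A ω).toReal) ≤
      liminf (fun n => ENNReal.ofReal (w n ω)) atTop := by
    filter_upwards [hφ.ae_locallyIntegrable hA hAi,
      ae_topExponent_eq_limsup_nat hφ hA hAi one_pos, ae_topExponent_finite hφ hA hAi,
      ae_tendsto_birkhoffAverage (hφ.measurePreserving 1) hEi] with ω h h1 h2 h3
    set l := (topExponent φ A ω).toReal with hl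
    have hl' : topExponent φ A ω = (l : EReal) := (EReal.coe_toReal h2.2 h2.1).symm
    -- The slack 1/(m+1) is split evenly between the limsup of the log norm and the limit of the
    -- energy average.
    have key : ∀ m : ℕ, ENNReal.ofReal (G ω - l - 1 / ((m : ℝ) + 1)) ≤
        liminf (fun n => ENNReal.ofReal (w n ω)) atTop := by
      intro m
      have hδ : 0 < 1 / ((m : ℝ) + 1) := Nat.one_div_pos_of_nat
      have h4 : limsup (fun k : ℕ => ((logNorm φ A (k * 1) ω / (k * 1) : ℝ) : EReal)) atTop <
          ((l + 1 / ((m : ℝ) + 1) / 2 : ℝ) : EReal) := by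
        rw [← h1, hl', EReal.coe_lt_coe_iff]
        linarith
      have h5 := (tendsto_add_atTop_nat 1).eventually (eventually_lt_of_limsup_lt h4)
      have h6 := (tendsto_add_atTop_nat 1).eventually (h3.eventually_const_lt
        (show G ω - 1 / ((m : ℝ) + 1) / 2 < G ω by linarith))
      refine le_liminf_of_le (by isBoundedDefault) ?_
      filter_upwards [h5, h6] with n hn hn'
      refine ENNReal.ofReal_le_ofReal ?_
      rw [EReal.coe_lt_coe_iff, mul_one] at hn
      rw [birkhoffAverage, smul_eq_mul, ← div_eq_inv_mul, ← energy_nat_mul hφ h, mul_one] at hn'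
      simp only [hw, sub_div]
      linarith
    have hlimm : Tendsto (fun m : ℕ => ENNReal.ofReal (G ω - l - 1 / ((m : ℝ) + 1))) atTop
        (𝓝 (ENNReal.ofReal (G ω - l))) := by
      refine ENNReal.tendsto_ofReal ?_
      simpa using (tendsto_one_div_add_atTop_nhds_zero_nat (𝕜 := ℝ)).const_sub (G ω - l)
    exact le_of_tendsto' hlimm key
  have hfatou := lintegral_liminf_le' (μ := μ) (u := atTop)
    (f := fun n ω => ENNReal.ofReal (w n ω)) fun n => (hwi n).aemeasurable.ennreal_ofReal
  have hlim : liminf (fun n => ∫⁻ ω, ENNReal.ofReal (w n ω) ∂μ) atTop ≤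
      ENNReal.ofReal (∫ ω, ‖A ω‖ ∂μ - (integratedTopExponent μ φ A + ε)) := by
    refine liminf_le_of_le (by isBoundedDefault) fun b hb => ?_
    obtain ⟨n, hn⟩ := hb.exists
    refine hn.trans ?_
    rw [← ofReal_integral_eq_lintegral_ofReal (hwi n) (hw0 n)]
    exact ENNReal.ofReal_le_ofReal (hint n)
  have hD : Integrable (fun ω => G ω - (topExponent φ A ω).toReal) μ :=
    integrable_condExp.sub (integrable_topExponent hφ hA hAi)
  have hD' := hD.pos_part
  have hDint : ∫ ω, (G ω - (topExponent φ A ω).toReal) ∂μ =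
      ∫ ω, ‖A ω‖ ∂μ - integratedTopExponent μ φ A := by
    rw [integral_sub integrable_condExp (integrable_topExponent hφ hA hAi), hGint]
    rfl
  -- `ENNReal.ofReal` keeps only the positive part of the integrand, which can only increase the
  -- integral, so the sign of G − λ₁ is irrelevant.
  have h1 : ENNReal.ofReal (∫ ω, ‖A ω‖ ∂μ - integratedTopExponent μ φ A) ≤
      ∫⁻ ω, ENNReal.ofReal (G ω - (topExponent φ A ω).toReal) ∂μ := by
    have h2 := ofReal_integral_eq_lintegral_ofReal hD' (ae_of_all _ fun ω => le_max_right _ _)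
    simp only [ENNReal.ofReal_max, ENNReal.ofReal_zero, max_zero] at h2
    rw [← h2, ← hDint]
    exact ENNReal.ofReal_le_ofReal (integral_mono hD hD' fun ω => le_max_left _ _)
  have h2 := (h1.trans (lintegral_mono_ae hpt)).trans (hfatou.trans hlim)
  have h3 : 0 ≤ ∫ ω, ‖A ω‖ ∂μ - (integratedTopExponent μ φ A + ε) :=
    (integral_nonneg_of_ae (hw0 0)).trans (hint 0)
  rw [ENNReal.ofReal_le_ofReal_iff h3] at h2
  linarith

end TopExponent

/-! ### Perturbing the generator -/

section Semicontinuity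

/-- With f the energy of A and g that of B − A: the first bound comes from log x ≤ x − 1 and the
Grönwall difference estimate g e^{2f+g}, divided by ‖Φ_A‖ ≥ e^{−f}. It is small with g but need not
be integrable; the cruder second bound is linear in the energies. -/
theorem logNorm_sub_le {M : Type*} {φ : ℝ → M → M} {A B : M → Mat} {ω : M}
    (hadd : ∀ t s, φ (t + s) = φ t ∘ φ s)
    (hA : LocallyIntegrable (fun s => A (φ s ω)) volume)
    (hB : LocallyIntegrable (fun s => B (φ s ω)) volume) {t : ℝ} (ht : 0 ≤ t) :
    logNorm φ B t ω - logNorm φ A t ω ≤ energy φ (fun ω => B ω - A ω) t ω *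
        Real.exp (3 * energy φ A t ω + energy φ (fun ω => B ω - A ω) t ω) ∧
    logNorm φ B t ω - logNorm φ A t ω ≤
        2 * energy φ A t ω + energy φ (fun ω => B ω - A ω) t ω := by
  set f := energy φ A t ω with hf
  set g := energy φ (fun ω => B ω - A ω) t ω with hg
  have hBA : LocallyIntegrable (fun s => B (φ s ω) - A (φ s ω)) volume := hB.sub hA
  constructor
  · have h1 := isCaratheodorySolution_cocycle hA
    have h2 := isCaratheodorySolution_cocycle hB
    have h3 := norm_sub_le_of_integral_equation hA hB h1.continuous h1.integral_eq h2.continuous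
      h2.integral_eq ht
    rw [norm_one, one_mul] at h3
    change ‖cocycle φ B t ω - cocycle φ A t ω‖ ≤ g * Real.exp (f + g) * Real.exp f at h3
    have h4 := exp_neg_energy_le_norm_cocycle hadd hA ht
    have h5 := exp_neg_energy_le_norm_cocycle hadd hB ht
    have hpA : 0 < ‖cocycle φ A t ω‖ := (Real.exp_pos _).trans_le h4
    have hpB : 0 < ‖cocycle φ B t ω‖ := (Real.exp_pos _).trans_le h5
    have hg0 : 0 ≤ g := energy_nonneg ht
    have h6 := Real.log_le_sub_one_of_pos (div_pos hpB hpA)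
    rw [Real.log_div hpB.ne' hpA.ne'] at h6
    refine h6.trans ?_
    rw [div_sub_one hpA.ne', div_le_iff₀ hpA]
    calc ‖cocycle φ B t ω‖ - ‖cocycle φ A t ω‖
        ≤ ‖cocycle φ B t ω - cocycle φ A t ω‖ := norm_sub_norm_le _ _
      _ ≤ g * Real.exp (f + g) * Real.exp f := h3
      _ = g * Real.exp (3 * f + g) * Real.exp (-f) := by
        rw [mul_assoc, mul_assoc, ← Real.exp_add, ← Real.exp_add]; ring_nf
      _ ≤ _ := by gcongr
  · have h1 := (abs_le.1 (abs_log_norm_cocycle_le hadd hA ht)).1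
    have h2 := (abs_le.1 (abs_log_norm_cocycle_le hadd hB ht)).2
    have h3 : energy φ B t ω ≤ f + g := by
      rw [hf, hg, energy, energy, energy, ← intervalIntegral.integral_add
        (hA.norm_comp.intervalIntegrable 0 t) (hBA.norm_comp.intervalIntegrable 0 t)]
      refine intervalIntegral.integral_mono_on ht (hB.norm_comp.intervalIntegrable 0 t)
        ((hA.norm_comp.intervalIntegrable 0 t).add (hBA.norm_comp.intervalIntegrable 0 t)) fun q _ => ?_
      simpa using norm_add_le (A (φ q ω)) (B (φ q ω) - A (φ q ω))
    simp only [logNorm]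
    linarith

variable {M : Type*} [MeasurableSpace M] {μ : Measure M} {φ : ℝ → M → M} {A B : M → Mat}

theorem measurable_energy (hφ : IsMeasurePreservingFlow μ φ) (hA : StronglyMeasurable A) {t : ℝ}
    (ht : 0 ≤ t) : Measurable (energy φ A t) := by
  have := (hφ.stronglyMeasurable_comp hA.norm).integral_prod_right'
    (ν := volume.restrict (Set.Ioc 0 t))
  refine (congrArg Measurable (funext fun ω => ?_)).mp this.measurable
  rw [energy, intervalIntegral.integral_of_le ht]

theorem integral_logNorm_le [SFinite μ] (hφ : IsMeasurePreservingFlow μ φ)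
    (hA : StronglyMeasurable A) (hAi : Integrable A μ) (hB : StronglyMeasurable B)
    (hBi : Integrable B μ) {t K : ℝ} (ht : 0 ≤ t) (hK : 0 ≤ K) :
    ∫ ω, logNorm φ B t ω ∂μ ≤ ∫ ω, logNorm φ A t ω ∂μ +
      Real.exp (3 * K + 1) * (t * ∫ ω, ‖B ω - A ω‖ ∂μ) +
        2 * ∫ ω in {ω | K < energy φ A t ω}, energy φ A t ω ∂μ := by
  have hBA : StronglyMeasurable fun ω => B ω - A ω := hB.sub hA
  have hBAi : Integrable (fun ω => B ω - A ω) μ := hBi.sub hAi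
  have hS : MeasurableSet {ω | K < energy φ A t ω} :=
    measurableSet_lt measurable_const (measurable_energy hφ hA ht)
  have hg : ∫ ω, energy φ (fun ω => B ω - A ω) t ω ∂μ = t * ∫ ω, ‖B ω - A ω‖ ∂μ :=
    hφ.integral_intervalIntegral hBA.norm hBAi.norm ht
  have hgi := integrable_energy hφ hBA hBAi ht
  have hfi := (integrable_energy hφ hA hAi ht).indicator hS
  have hLA := integrable_logNorm hφ hA hAi ht
  have hsum : Integrable (fun ω => logNorm φ A t ω +
      Real.exp (3 * K + 1) * energy φ (fun ω => B ω - A ω) t ω) μ := hLA.add (hgi.const_mul _)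
  rw [← hg, ← integral_indicator hS, ← integral_const_mul, ← integral_const_mul,
    ← integral_add hLA (hgi.const_mul _),
    ← integral_add hsum (hfi.const_mul _)]
  refine integral_mono_ae (integrable_logNorm hφ hB hBi ht) (hsum.add (hfi.const_mul _)) ?_
  filter_upwards [hφ.ae_locallyIntegrable hA hAi, hφ.ae_locallyIntegrable hB hBi] with ω h1 h2
  obtain ⟨h3, h4⟩ := logNorm_sub_le hφ.map_add h1 h2 ht
  have hf0 : 0 ≤ energy φ A t ω := energy_nonneg ht
  have hg0 : 0 ≤ energy φ (fun ω => B ω - A ω) t ω := energy_nonneg ht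
  set f := energy φ A t ω with hf
  set g := energy φ (fun ω => B ω - A ω) t ω with hg
  have hC : 3 * K + 1 + 1 ≤ Real.exp (3 * K + 1) := Real.add_one_le_exp _
  -- If f > K, the linear bound suffices. If f ≤ K and g ≤ 1, the exponential bound has exponent at
  -- most 3K + 1. If f ≤ K and g ≥ 1, then 2f + g ≤ (2K + 1)g, which is absorbed by e^{3K+1} g.
  by_cases hfK : K < f
  · rw [Set.indicator_of_mem (show ω ∈ {ω | K < energy φ A t ω} from hfK)]
    nlinarith
  · rw [Set.indicator_of_notMem (show ω ∉ {ω | K < energy φ A t ω} from hfK), mul_zero, add_zero]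
    rw [not_lt] at hfK
    rcases le_total g 1 with hg1 | hg1
    · have : g * Real.exp (3 * f + g) ≤ g * Real.exp (3 * K + 1) := by gcongr
      linarith
    · nlinarith

theorem tendsto_setIntegral_energy_tail [SFinite μ] (hφ : IsMeasurePreservingFlow μ φ)
    (hA : StronglyMeasurable A) (hAi : Integrable A μ) {t : ℝ} (ht : 0 ≤ t) :
    Tendsto (fun K : ℕ => ∫ ω in {ω | (K : ℝ) < energy φ A t ω}, energy φ A t ω ∂μ) atTop
      (𝓝 0) := by
  have h := tendsto_setIntegral_of_antitone (μ := μ) (f := energy φ A t)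
    (s := fun K : ℕ => {ω | (K : ℝ) < energy φ A t ω})
    (fun K => measurableSet_lt measurable_const (measurable_energy hφ hA ht))
    (fun K L hKL ω (hω : (L : ℝ) < energy φ A t ω) =>
      lt_of_le_of_lt (Nat.cast_le.2 hKL : (K : ℝ) ≤ L) hω)
    ⟨0, (integrable_energy hφ hA hAi ht).integrableOn⟩
  have hempty : (⋂ K : ℕ, {ω | (K : ℝ) < energy φ A t ω}) = (∅ : Set M) := by
    refine Set.eq_empty_of_forall_notMem fun ω hω => ?_
    obtain ⟨K, hK⟩ := exists_nat_ge (energy φ A t ω)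
    exact absurd (Set.mem_iInter.1 hω K) (not_lt.2 hK)
  rwa [hempty, setIntegral_empty] at h

/-- The threshold d/(1+d) is below 1, which rules out infinite distance; monotonicity of s/(1+s)
then gives s < d, and on a probability space the L¹ norm is at most the L^p norm. -/
theorem integral_norm_sub_lt_of_sigma_lt [IsProbabilityMeasure μ] {p : ℝ≥0∞} (hp : 1 ≤ p)
    (hA : StronglyMeasurable A) (hB : StronglyMeasurable B) {d : ℝ} (hd : 0 < d)
    (h : sigma μ p A B < d / (1 + d)) : ∫ ω, ‖B ω - A ω‖ ∂μ < d := by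
  have hd1 : d / (1 + d) < 1 := by rw [div_lt_one (by linarith)]; linarith
  rw [sigma] at h
  split_ifs at h with hfin
  · set s := (sigmaHat μ p A B).toReal with hs
    have hs0 : 0 ≤ s := ENNReal.toReal_nonneg
    have hsd : s < d := by
      rw [div_lt_div_iff₀ (by linarith) (by linarith)] at h
      linarith
    refine lt_of_le_of_lt ?_ hsd
    have hm : AEStronglyMeasurable (fun ω => A ω - B ω) μ := (hA.sub hB).aestronglyMeasurable
    have h1 := eLpNorm_le_eLpNorm_of_exponent_le hp hm
    have h2 : ∫ ω, ‖B ω - A ω‖ ∂μ = (eLpNorm (fun ω => A ω - B ω) 1 μ).toReal := by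
      rw [eLpNorm_one_eq_lintegral_enorm, ← integral_norm_eq_lintegral_enorm hm]
      simp only [norm_sub_rev]
    rw [h2, hs]
    exact ENNReal.toReal_mono hfin.ne h1
  · exact absurd h (not_lt.2 hd1.le)

theorem integratedTopExponent_upperSemicontinuous [IsProbabilityMeasure μ]
    (hφ : IsMeasurePreservingFlow μ φ) {p : ℝ≥0∞} (hp : 1 ≤ p)
    (hA : StronglyMeasurable A) (hAi : Integrable A μ) {ε : ℝ} (hε : 0 < ε) :
    ∃ δ : ℝ, 0 < δ ∧ ∀ B ∈ integrableGenerators μ, sigma μ p A B < δ →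
      integratedTopExponent μ φ B < integratedTopExponent μ φ A + ε := by
  obtain ⟨n, hn0, hn⟩ := exists_integral_logNorm_lt hφ hA hAi (half_pos hε)
  have hn' : (0 : ℝ) < n := by exact_mod_cast hn0
  obtain ⟨K, hK⟩ := ((tendsto_setIntegral_energy_tail hφ hA hAi hn'.le).eventually_lt_const
    (show (0 : ℝ) < n * ε / 8 by positivity)).exists
  set C := Real.exp (3 * K + 1) with hC
  have hC0 : 0 < C := Real.exp_pos _
  -- Error budget for the integral at time n: nε/2 from the choice of n, C·n·d = nε/4 from the L¹
  -- distance, and 2·nε/8 from the tail. Both n and K depend only on A and ε, so δ is uniform in B.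
  set d := ε / (4 * C) with hd
  have hd0 : 0 < d := by positivity
  refine ⟨d / (1 + d), by positivity, fun B hB hAB => ?_⟩
  have h1 := integral_norm_sub_lt_of_sigma_lt hp hA hB.1 hd0 hAB
  have h2 := integral_logNorm_le hφ hA hAi hB.1 hB.2 hn'.le (Nat.cast_nonneg K)
  have h3 := integratedTopExponent_le hφ hB.1 hB.2 hn'
  have h4 : C * (n * ∫ ω, ‖B ω - A ω‖ ∂μ) ≤ n * ε / 4 := by
    calc C * (n * ∫ ω, ‖B ω - A ω‖ ∂μ) ≤ C * (n * d) := by gcongr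
      _ = n * ε / 4 := by rw [hd]; field_simp
  rw [div_lt_iff₀ hn'] at hn
  refine lt_of_le_of_lt h3 ?_
  rw [div_lt_iff₀ hn']
  linarith

end Semicontinuity

end LinearCocycle

theorem mainTheorem2 {M : Type*} [MeasurableSpace M] (μ : Measure M) [IsProbabilityMeasure μ]
    (φ : ℝ → M → M) (hφ : LinearCocycle.IsMeasurePreservingFlow μ φ)
    (p : ℝ≥0∞) (hp : 1 ≤ p) (hp_top : p ≠ ∞) :
    (∀ A ∈ LinearCocycle.integrableGenerators μ,
      (∀ᵐ ω ∂μ, ∃! X : ℝ → LinearCocycle.Mat, LinearCocycle.IsCaratheodorySolution φ A ω X) ∧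
      (∀ᵐ ω ∂μ, LinearCocycle.topExponent φ A ω ≠ ⊥ ∧ LinearCocycle.topExponent φ A ω ≠ ⊤) ∧
      Integrable (fun ω => (LinearCocycle.topExponent φ A ω).toReal) μ) ∧
    (∀ A ∈ LinearCocycle.integrableGenerators μ, ∀ ε : ℝ, 0 < ε → ∃ δ : ℝ, 0 < δ ∧
      ∀ B ∈ LinearCocycle.integrableGenerators μ, LinearCocycle.sigma μ p A B < δ →
        LinearCocycle.integratedTopExponent μ φ B
          < LinearCocycle.integratedTopExponent μ φ A + ε) := by
  refine ⟨fun A hA => ⟨?_, LinearCocycle.ae_topExponent_finite hφ hA.1 hA.2,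
    LinearCocycle.integrable_topExponent hφ hA.1 hA.2⟩, fun A hA ε hε =>
    LinearCocycle.integratedTopExponent_upperSemicontinuous hφ hp hA.1 hA.2 hε⟩
  filter_upwards [hφ.ae_locallyIntegrable hA.1 hA.2] with ω hω
  obtain ⟨X, hX⟩ := LinearCocycle.exists_isCaratheodorySolution hω
  exact ⟨X, hX, fun Y hY => hY.eq hX⟩
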